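/- Let $p=(p_i^j)$ be an $N\times N$ matrix with non-negative entries. Assume that $p$ is fully indecomposable (every non-empty proper set $R$ of rows has positive entries in more than $|R|$ columns) and has more than $2N$ positive entries; both hold in particular if $N\ge 3$ and all $p_i^j>0$. Assume that there is a unique permutation $\sigma_*$ (the maximum-likelihood, ML, perfect matching) maximizing $\prod_i p_i^{\sigma(i)}$, and write $\sigma_*$ also for its $0/1$ matrix, $\sigma_{*i}^{\ j}=1$ if $j=\sigma_*(i)$ and $0$ otherwise. For $T>0$ let $P(T)=((p_i^j)^{1/T})$. For a doubly stochastic matrix $\beta$ the Bethe free energy is $$\mathcal F_T(\beta)=T\sum_{i,j}\Bigl(\beta_i^j\ln\frac{\beta_i^j}{(p_i^j)^{1/T}}-(1-\beta_i^j)\ln(1-\beta_i^j)\Bigr),$$ with $0\ln 0=0$ and with the value $+\infty$ if $\beta_i^j>0=p_i^j$ for some $(i,j)$. A BP solution at temperature $T$ is a doubly stochastic $\beta$ such that, for some real $\mu_i,\mu^j$, $$\beta_i^j(1-\beta_i^j)=(p_i^j)^{1/T}e^{\mu_i+\mu^j}\quad\text{for all } i,j.$$ Then there is a temperature $T_c\in(0,\infty)$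 with the following properties. 1. $\det\bigl(P(T_c)_i^j-2\sigma_{*i}^{\ j}P(T_c)_i^j\bigr)_{i,j}=0$. 2. There are $\varepsilon>0$ and a continuous family $T\mapsto\beta(T)$ on $[T_c,T_c+\varepsilon)$ of matrices with $\beta(T_c)=\sigma_*$ such that for every $T\in(T_c,T_c+\varepsilon)$ the matrix $\beta(T)$ is a BP solution at temperature $T$, satisfies $0<\beta(T)_i^j<1$ for all $(i,j)$ with $p_i^j>0$, is a local minimum of $\mathcal F_T$ on the set of doubly stochastic matrices, and satisfies $\mathcal F_T(\beta(T))<\mathcal F_T(\sigma_*)$. 3. For $0<T<T_c$ there is no BP solution at temperature $T$ with a non-integer entry. -/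

import Mathlib

/-- The matrix `P = ((p i j)^(1/T))` at temperature `T`. -/
noncomputable def thermalMatrix {N : ℕ} (p : Matrix (Fin N) (Fin N) ℝ) (T : ℝ) :
    Matrix (Fin N) (Fin N) ℝ :=
  Matrix.of fun i j => (p i j) ^ (1 / T)

/-- `σ` is the unique perfect matching of maximal weight (the maximum-likelihood matching). -/
def IsMLMatching {N : ℕ} (p : Matrix (Fin N) (Fin N) ℝ) (σ : Equiv.Perm (Fin N)) : Prop :=
  ∀ τ : Equiv.Perm (Fin N), τ ≠ σ → ∏ i, p i (τ i) < ∏ i, p i (σ i)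

/-- Full indecomposability of a non-negative matrix: every non-empty proper set `R` of rows has
positive entries in more than `|R|` columns. -/
def FullyIndecomposable {N : ℕ} (p : Matrix (Fin N) (Fin N) ℝ) : Prop :=
  ∀ R : Finset (Fin N), R.Nonempty → R ≠ Finset.univ →
    R.card < {j : Fin N | ∃ i ∈ R, 0 < p i j}.ncard

/-- The Bethe free energy
`T * ∑ (β ln (β / p^(1/T)) - (1 - β) ln (1 - β))`, with `0 ln 0 = 0`; it is `+∞` when `β` puts
positive mass on an entry with `p i j = 0`. -/
noncomputable def betheFreeEnergy {N : ℕ} (p : Matrix (Fin N) (Fin N) ℝ) (T : ℝ)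
    (β : Matrix (Fin N) (Fin N) ℝ) : EReal :=
  open Classical in
  if ∃ i j, p i j = 0 ∧ β i j ≠ 0 then ⊤
  else ((T * ∑ i, ∑ j, (β i j * Real.log (β i j / thermalMatrix p T i j)
    - (1 - β i j) * Real.log (1 - β i j)) : ℝ) : EReal)

/-- Solutions of the belief-propagation equations: `β` is doubly stochastic and
`β (1 - β) = p^(1/T) exp (μ_i + μ^j)` for some real Lagrange multipliers. -/
def IsBPSolution {N : ℕ} (p : Matrix (Fin N) (Fin N) ℝ) (T : ℝ)
    (β : Matrix (Fin N) (Fin N) ℝ) : Prop :=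
  β ∈ doublyStochastic ℝ (Fin N) ∧
    ∃ μ ν : Fin N → ℝ, ∀ i j,
      β i j * (1 - β i j) = thermalMatrix p T i j * Real.exp (μ i + ν j)

/-- The matrix `P i j - 2 σ i j P i j`, where `σ i j = 1` if `j = σ i` and `0` otherwise. -/
noncomputable def criticalMatrix {N : ℕ} (p : Matrix (Fin N) (Fin N) ℝ)
    (σ : Equiv.Perm (Fin N)) (T : ℝ) : Matrix (Fin N) (Fin N) ℝ :=
  Matrix.of fun i j => thermalMatrix p T i j - 2 * σ.permMatrix ℝ i j * thermalMatrix p T i j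

/-! On the polytope of doubly stochastic matrices supported where `p > 0`, the free energy is `T *
S(β) + ⟨c, β⟩`, with `S` the sum of `betheTerm` over the entries and `c = -log p`. Permutation
matrices have `S = 0`, so `σ` is the cheapest of them at every temperature.

Two facts control the minimizers. The second variation is a sum of squares along each row and is
positive definite at interior points: a null direction would spread over all rows and force at most
two support entries per row (`secondVariation_pos`). And `betheTerm` has infinite slope at `0` and
`1`, so a `t ln t` comparison with a counting argument shows that a minimizer is interior or a
permutation matrix (`isInteriorOn_or_eq_permMatrix`). Hence for every `T > 0` the minimizer is
unique, and by compactness it is continuous in `T`.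

`Tc` is the supremum of the temperatures at which `σ` is the minimizer. It is positive because the
cost grows linearly away from `σ` while `S` falls at most linearly, and finite because `S` is
negative somewhere. Above `Tc` the minimizer is interior, hence a critical point, hence a BP
solution. Conversely a BP solution is an interior critical point, so it beats `σ`; then it has `S <
0` and beats `σ` at all higher temperatures too, which excludes `T < Tc`.

For the determinant, `exp ν` is a null vector of the thermal matrix with each matching entry
multiplied by minus the row ratio. These ratios tend to `1` as the minimizer tends to `σ`, and the
limit is the critical matrix. -/

/-! ### The scalar Bethe term -/

/-- The entrywise contribution `x ln x - (1 - x) ln (1 - x)` to the Bethe free energy. -/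
noncomputable def betheTerm (x : ℝ) : ℝ := x * Real.log x - (1 - x) * Real.log (1 - x)

theorem betheTerm_zero : betheTerm 0 = 0 := by simp [betheTerm]

theorem betheTerm_one : betheTerm 1 = 0 := by simp [betheTerm]

theorem betheTerm_half_eq_zero : betheTerm (1 / 2) = 0 := by norm_num [betheTerm]

theorem continuous_betheTerm : Continuous betheTerm :=
  Real.continuous_mul_log.sub (Real.continuous_mul_log.comp (continuous_const.sub continuous_id))

theorem hasDerivAt_betheTerm {x : ℝ} (h0 : 0 < x) (h1 : x < 1) :
    HasDerivAt betheTerm (Real.log x + Real.log (1 - x) + 2) x := by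
  have ha := Real.hasDerivAt_mul_log h0.ne'
  have hb := (Real.hasDerivAt_mul_log (x := 1 - x) (by linarith)).comp x
    ((hasDerivAt_id x).const_sub 1)
  exact (ha.sub hb).congr_deriv (by ring)

theorem sub_one_le_mul_log {y : ℝ} (hy : 0 ≤ y) : y - 1 ≤ y * Real.log y := by
  rcases hy.eq_or_lt with rfl | hy
  · simp
  · have h := mul_le_mul_of_nonneg_left (Real.one_sub_inv_le_log_of_pos hy) hy.le
    rwa [mul_sub, mul_one, mul_inv_cancel₀ hy.ne'] at h

theorem mul_log_nonpos' {y : ℝ} (h0 : 0 ≤ y) (h1 : y ≤ 1) : y * Real.log y ≤ 0 :=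
  mul_nonpos_of_nonneg_of_nonpos h0 (Real.log_nonpos h0 h1)

/-- The coefficient of `t ln t` in the expansion of `betheTerm (b + t v)` at `t = 0`. -/
noncomputable def endpointSlope (b v : ℝ) : ℝ := if b = 0 ∨ b = 1 then v else 0

/-- The slope of `betheTerm` is infinite at both endpoints, so leaving one changes the value at
order `t ln t`, whereas an interior move costs only `O(t)`. -/
theorem exists_betheTerm_sub_le {b v : ℝ} (hb0 : 0 ≤ b) (hb1 : b ≤ 1) (hv0 : 0 ≤ b + v)
    (hv1 : b + v ≤ 1) :
    ∃ C, ∀ᶠ t in nhdsWithin (0 : ℝ) (Set.Ioi 0),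
      betheTerm (b + t * v) - betheTerm b ≤ endpointSlope b v * (t * Real.log t) + C * t := by
  have hsmall : ∀ᶠ t in nhdsWithin (0 : ℝ) (Set.Ioi 0), t ∈ Set.Ioo (0 : ℝ) 1 :=
    Ioo_mem_nhdsGT one_pos
  rcases eq_or_ne v 0 with rfl | hv
  · exact ⟨0, by simp [endpointSlope]⟩
  rcases hb0.eq_or_lt with rfl | hb0
  · have hvp : 0 < v := lt_of_le_of_ne (by simpa using hv0) hv.symm
    refine ⟨v * Real.log v + v, hsmall.mono fun t ht => ?_⟩
    have h1 : t * v ≤ 1 := by nlinarith [ht.1, ht.2]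
    have := sub_one_le_mul_log (y := 1 - t * v) (by linarith)
    rw [betheTerm_zero]
    simp only [endpointSlope, true_or, if_true, zero_add, betheTerm,
      Real.log_mul ht.1.ne' hvp.ne']
    linarith
  rcases hb1.eq_or_lt with rfl | hb1
  · have hvn : v < 0 := lt_of_le_of_ne (by linarith) hv
    refine ⟨v * Real.log (-v), hsmall.mono fun t ht => ?_⟩
    have h1 : 0 ≤ 1 + t * v := by nlinarith [ht.1, ht.2]
    have h2 := mul_log_nonpos' h1 (by nlinarith [ht.1, ht.2])
    have h3 : 1 - (1 + t * v) = t * (-v) := by ring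
    rw [betheTerm_one]
    simp only [endpointSlope, or_true, if_true, betheTerm, h3,
      Real.log_mul ht.1.ne' (neg_pos.2 hvn).ne']
    linarith
  · set d := Real.log b + Real.log (1 - b) + 2
    have hd : HasDerivAt (fun t : ℝ => betheTerm (b + t * v)) (d * v) 0 := by
      have hlin : HasDerivAt (fun t : ℝ => b + t * v) v 0 := by
        simpa using ((hasDerivAt_id (0 : ℝ)).mul_const v).const_add b
      have hf : HasDerivAt betheTerm d (b + 0 * v) := by
        simpa using hasDerivAt_betheTerm hb0 hb1
      exact hf.comp 0 hlin
    have hO := hd.isLittleO.def (c := 1) one_pos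
    -- The extra `1` absorbs the `o(t)` error of differentiability.
    refine ⟨d * v + 1, ?_⟩
    filter_upwards [hsmall, nhdsWithin_le_nhds hO] with t ht h
    simp only [sub_zero, zero_mul, add_zero, smul_eq_mul, Real.norm_eq_abs, abs_of_pos ht.1,
      one_mul] at h
    simp only [endpointSlope, hb0.ne', hb1.ne, or_self, if_false, zero_mul, zero_add]
    have := (abs_le.1 h).2
    linarith

/-- With `d = 1 - b k`, the other entries contribute at least `d ln d` up to `O(d)`, which cancels
the `-d ln d` of entry `k`. The remaining bound is linear in `d`, so a linear cost can compensate it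
at low temperature. -/
theorem neg_mul_le_sum_betheTerm {ι : Type*} [Fintype ι] [DecidableEq ι] {b : ι → ℝ}
    (hb : ∀ j, 0 ≤ b j) (hsum : ∑ j, b j = 1) (k : ι) :
    -(Fintype.card ι * (1 - b k)) ≤ ∑ j, betheTerm (b j) := by
  have hle : ∀ j, b j ≤ 1 := fun j => hsum ▸ Finset.single_le_sum (fun i _ => hb i)
    (Finset.mem_univ j)
  set d := 1 - b k with hd
  have herase : ∑ j ∈ Finset.univ.erase k, b j = d := by
    rw [← hsum, ← Finset.add_sum_erase _ _ (Finset.mem_univ k)] at hd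
    linarith
  have hd0 : 0 ≤ d := by linarith [hle k]
  have hterm : ∀ j ∈ Finset.univ.erase k, b j * Real.log d - d ≤ betheTerm (b j) := by
    intro j hj
    have h1 := mul_log_nonpos' (y := 1 - b j) (by linarith [hle j]) (by linarith [hb j])
    have h2 : b j ≤ d := herase ▸ Finset.single_le_sum (fun i _ => hb i) hj
    rcases hd0.eq_or_lt with h0 | h0
    · have : b j = 0 := le_antisymm (h0 ▸ h2) (hb j)
      simp [this, ← h0, betheTerm_zero]
    rcases (hb j).eq_or_lt with hz | hz
    · simp [← hz, betheTerm_zero, hd0]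
    · have h3 := mul_le_mul_of_nonneg_left (sub_one_le_mul_log (div_nonneg hz.le h0.le)) h0.le
      rw [Real.log_div hz.ne' h0.ne'] at h3
      have h4 : d * (b j / d * (Real.log (b j) - Real.log d))
          = b j * Real.log (b j) - b j * Real.log d := by field_simp
      have h5 : d * (b j / d - 1) = b j - d := by field_simp
      rw [h4, h5] at h3
      simp only [betheTerm]
      linarith
  have hmain := Finset.sum_le_sum hterm
  rw [Finset.sum_sub_distrib, ← Finset.sum_mul, herase, Finset.sum_const, nsmul_eq_mul,
    Finset.card_erase_of_mem (Finset.mem_univ k), Finset.card_univ,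
    Nat.cast_sub (Fintype.card_pos_iff.2 ⟨k⟩)] at hmain
  have hk := sub_one_le_mul_log (hb k)
  have hfk : betheTerm (b k) = b k * Real.log (b k) - d * Real.log d := rfl
  rw [← Finset.add_sum_erase _ _ (Finset.mem_univ k), hfk]
  push_cast at hmain
  linarith

/-! ### The second-order form of the Bethe free energy on a simplex -/

section SimplexForm

variable {ι : Type*} {s : Finset ι} {b v : ι → ℝ}

/-- A coefficient `1 / b - 1 / (1 - b)` is negative once `b > 1/2`, so positivity is not termwise.
Averaging with the weights `b j` produces brackets that `sum_sq_div_sub_eq` turns into sums of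
squares. -/
theorem sum_mul_sub_eq (hb0 : ∀ j ∈ s, 0 < b j) (hb1 : ∀ j ∈ s, b j < 1)
    (hb : ∑ j ∈ s, b j = 1) :
    ∑ j ∈ s, v j ^ 2 * (1 / b j - 1 / (1 - b j)) =
      ∑ j ∈ s, b j * (∑ k ∈ s, v k ^ 2 / b k - v j ^ 2 / (b j * (1 - b j))) := by
  simp_rw [mul_sub (b _) (∑ k ∈ s, v k ^ 2 / b k)]
  rw [Finset.sum_sub_distrib, ← Finset.sum_mul, hb, one_mul, ← Finset.sum_sub_distrib]
  refine Finset.sum_congr rfl fun j hj => ?_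
  have := (hb0 j hj).ne'
  have : 1 - b j ≠ 0 := (sub_pos.2 (hb1 j hj)).ne'
  field_simp

variable [DecidableEq ι]

theorem sum_sq_div_sub_eq (hb0 : ∀ j ∈ s, 0 < b j) (hb1 : ∀ j ∈ s, b j < 1)
    (hb : ∑ j ∈ s, b j = 1) (hv : ∑ j ∈ s, v j = 0) {j : ι} (hj : j ∈ s) :
    ∑ k ∈ s, v k ^ 2 / b k - v j ^ 2 / (b j * (1 - b j)) =
      ∑ k ∈ s.erase j, b k * (v k / b k + v j / (1 - b j)) ^ 2 := by
  have hbj := (hb0 j hj).ne'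
  have hbj1 : 1 - b j ≠ 0 := (sub_pos.2 (hb1 j hj)).ne'
  have h1 : ∑ k ∈ s.erase j, b k = 1 - b j := by
    rw [← hb, ← Finset.add_sum_erase s b hj]; ring
  have h2 : ∑ k ∈ s.erase j, v k = - v j := by
    rw [← Finset.add_sum_erase s v hj] at hv; linarith
  have h3 : ∀ k ∈ s.erase j, b k * (v k / b k + v j / (1 - b j)) ^ 2 =
      v k ^ 2 / b k + 2 * (v j / (1 - b j)) * v k + (v j / (1 - b j)) ^ 2 * b k := by
    intro k hk
    have := (hb0 k (Finset.mem_of_mem_erase hk)).ne'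
    field_simp
    ring
  rw [Finset.sum_congr rfl h3, Finset.sum_add_distrib, Finset.sum_add_distrib, ← Finset.mul_sum,
    ← Finset.mul_sum, h1, h2, ← Finset.add_sum_erase s _ hj]
  field_simp
  ring

theorem sum_mul_sub_nonneg_aux (hb0 : ∀ j ∈ s, 0 < b j) (hb1 : ∀ j ∈ s, b j < 1)
    (hb : ∑ j ∈ s, b j = 1) (hv : ∑ j ∈ s, v j = 0) {j : ι} (hj : j ∈ s) :
    0 ≤ ∑ k ∈ s, v k ^ 2 / b k - v j ^ 2 / (b j * (1 - b j)) := by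
  rw [sum_sq_div_sub_eq hb0 hb1 hb hv hj]
  exact Finset.sum_nonneg fun k hk =>
    mul_nonneg (hb0 k (Finset.mem_of_mem_erase hk)).le (sq_nonneg _)

/-- Convexity of the Bethe free energy on the simplex, to second order. -/
theorem simplexForm_nonneg (hb0 : ∀ j ∈ s, 0 < b j) (hb1 : ∀ j ∈ s, b j < 1)
    (hb : ∑ j ∈ s, b j = 1) (hv : ∑ j ∈ s, v j = 0) :
    0 ≤ ∑ j ∈ s, v j ^ 2 * (1 / b j - 1 / (1 - b j)) := by
  rw [sum_mul_sub_eq hb0 hb1 hb]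
  exact Finset.sum_nonneg fun j hj =>
    mul_nonneg (hb0 j hj).le (sum_mul_sub_nonneg_aux hb0 hb1 hb hv hj)

/-- Equality case: every square in the decomposition must vanish. -/
theorem div_eq_of_simplexForm_eq_zero (hb0 : ∀ j ∈ s, 0 < b j) (hb1 : ∀ j ∈ s, b j < 1)
    (hb : ∑ j ∈ s, b j = 1) (hv : ∑ j ∈ s, v j = 0)
    (hz : ∑ j ∈ s, v j ^ 2 * (1 / b j - 1 / (1 - b j)) = 0) {j k : ι} (hj : j ∈ s) (hk : k ∈ s)
    (hkj : k ≠ j) : v k / b k = -(v j / (1 - b j)) := by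
  rw [sum_mul_sub_eq hb0 hb1 hb, Finset.sum_eq_zero_iff_of_nonneg fun j hj =>
    mul_nonneg (hb0 j hj).le (sum_mul_sub_nonneg_aux hb0 hb1 hb hv hj)] at hz
  have h := (mul_eq_zero.1 (hz j hj)).resolve_left (hb0 j hj).ne'
  rw [sum_sq_div_sub_eq hb0 hb1 hb hv hj, Finset.sum_eq_zero_iff_of_nonneg fun k hk =>
    mul_nonneg (hb0 k (Finset.mem_of_mem_erase hk)).le (sq_nonneg _)] at h
  have h' := (mul_eq_zero.1 (h k (Finset.mem_erase.2 ⟨hkj, hk⟩))).resolve_left (hb0 k hk).ne'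
  have := pow_eq_zero_iff (two_ne_zero) |>.1 h'
  linarith

theorem ne_zero_of_simplexForm_eq_zero (hb0 : ∀ j ∈ s, 0 < b j) (hb1 : ∀ j ∈ s, b j < 1)
    (hb : ∑ j ∈ s, b j = 1) (hv : ∑ j ∈ s, v j = 0)
    (hz : ∑ j ∈ s, v j ^ 2 * (1 / b j - 1 / (1 - b j)) = 0) {j k : ι} (hj : j ∈ s)
    (hvj : v j ≠ 0) (hk : k ∈ s) : v k ≠ 0 := by
  rcases eq_or_ne k j with rfl | hkj
  · exact hvj
  have h := div_eq_of_simplexForm_eq_zero hb0 hb1 hb hv hz hj hk hkj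
  intro h0
  rw [h0, zero_div, eq_comm, neg_eq_zero, div_eq_zero_iff] at h
  rcases h with h | h
  · exact hvj h
  · linarith [hb1 j hj]

/-- Given three indices, comparing the equality relations pairwise yields `v x / b x = -(v x / (1 -
b x))`, so `v x = 0`, although one nonzero coordinate makes all of them nonzero. -/
theorem card_le_two_of_simplexForm_eq_zero (hb0 : ∀ j ∈ s, 0 < b j) (hb1 : ∀ j ∈ s, b j < 1)
    (hb : ∑ j ∈ s, b j = 1) (hv : ∑ j ∈ s, v j = 0)
    (hz : ∑ j ∈ s, v j ^ 2 * (1 / b j - 1 / (1 - b j)) = 0) {j : ι} (hj : j ∈ s)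
    (hvj : v j ≠ 0) : s.card ≤ 2 := by
  by_contra! hcard
  obtain ⟨x, hx, y, hy, z, hz', hxy, hxz, hyz⟩ := Finset.two_lt_card.1 hcard
  have e := fun {j k : ι} => div_eq_of_simplexForm_eq_zero (j := j) (k := k) hb0 hb1 hb hv hz
  have h1 := e hx hz' hxz.symm
  have h2 := e hy hz' hyz.symm
  have h3 := e hy hx hxy
  have hvx := ne_zero_of_simplexForm_eq_zero hb0 hb1 hb hv hz hj hvj hx
  have h4 : v x / b x = -(v x / (1 - b x)) := by rw [h3, ← h2, h1]
  have hx0 := (hb0 x hx).ne'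
  have hx1 : 1 - b x ≠ 0 := (sub_pos.2 (hb1 x hx)).ne'
  field_simp at h4
  apply hvx
  linarith

end SimplexForm

/-! ### The polytope of supported doubly stochastic matrices -/

/-- The doubly stochastic matrices vanishing wherever `p` vanishes. -/
def supportedPolytope {N : ℕ} (p : Matrix (Fin N) (Fin N) ℝ) : Set (Matrix (Fin N) (Fin N) ℝ) :=
  {β | β ∈ doublyStochastic ℝ (Fin N) ∧ ∀ i j, p i j = 0 → β i j = 0}

/-- All entries on the support of `p` lie strictly between `0` and `1`. -/
def IsInteriorOn {N : ℕ} (p β : Matrix (Fin N) (Fin N) ℝ) : Prop :=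
  ∀ i j, 0 < p i j → 0 < β i j ∧ β i j < 1

/-- The real-valued Bethe objective with temperature `T` and linear cost `c`. -/
noncomputable def betheObjective {N : ℕ} (c : Matrix (Fin N) (Fin N) ℝ) (T : ℝ)
    (β : Matrix (Fin N) (Fin N) ℝ) : ℝ :=
  ∑ i, ∑ j, (T * betheTerm (β i j) + c i j * β i j)

/-- The columns in which some row of `R` has a positive entry. -/
noncomputable def positiveCols {N : ℕ} (p : Matrix (Fin N) (Fin N) ℝ) (R : Finset (Fin N)) :
    Finset (Fin N) :=
  open Classical in Finset.univ.filter fun j => ∃ i ∈ R, 0 < p i j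

section Polytope

variable {N : ℕ} {p : Matrix (Fin N) (Fin N) ℝ}

theorem permMatrix_apply_eq (σ : Equiv.Perm (Fin N)) (i j : Fin N) :
    σ.permMatrix ℝ i j = if j = σ i then 1 else 0 := by
  simp [Equiv.Perm.permMatrix, PEquiv.toMatrix_apply, eq_comm]

theorem permMatrix_mem_supportedPolytope {τ : Equiv.Perm (Fin N)} (hτ : ∀ i, 0 < p i (τ i)) :
    τ.permMatrix ℝ ∈ supportedPolytope p := by
  refine ⟨permMatrix_mem_doublyStochastic, fun i j hij => ?_⟩
  rw [permMatrix_apply_eq, if_neg]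
  rintro rfl
  exact (hτ i).ne' hij

theorem convex_supportedPolytope : Convex ℝ (supportedPolytope p) := by
  intro x hx y hy a b ha hb hab
  refine ⟨convex_doublyStochastic hx.1 hy.1 ha hb hab, fun i j hij => ?_⟩
  simp [hx.2 i j hij, hy.2 i j hij]

theorem isCompact_supportedPolytope : IsCompact (supportedPolytope p) := by
  have hK : IsCompact (Set.pi Set.univ fun _ : Fin N => Set.pi Set.univ fun _ : Fin N =>
      Set.Icc (0 : ℝ) 1) :=
    isCompact_univ_pi fun _ => isCompact_univ_pi fun _ => isCompact_Icc
  refine IsCompact.of_isClosed_subset hK ?_ fun β hβ i _ j _ =>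
    ⟨nonneg_of_mem_doublyStochastic hβ.1, le_one_of_mem_doublyStochastic hβ.1⟩
  have : supportedPolytope p = {β : Matrix (Fin N) (Fin N) ℝ | (∀ i j, 0 ≤ β i j) ∧
      (∀ i, ∑ j, β i j = 1) ∧ (∀ j, ∑ i, β i j = 1) ∧ ∀ i j, p i j = 0 → β i j = 0} := by
    ext β
    simp only [supportedPolytope, mem_doublyStochastic_iff_sum, Set.mem_ofPred_eq, and_assoc]
  rw [this]
  have hc : ∀ i j, Continuous fun β : Matrix (Fin N) (Fin N) ℝ => β i j :=
    fun i j => continuous_id.matrix_elem i j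
  simp only [Set.ofPred_and, Set.ofPred_forall]
  refine IsClosed.inter ?_ (IsClosed.inter ?_ (IsClosed.inter ?_ ?_))
  · exact isClosed_iInter fun i => isClosed_iInter fun j => isClosed_le continuous_const (hc i j)
  · exact isClosed_iInter fun i => isClosed_eq (continuous_finsetSum _ fun j _ => hc i j)
      continuous_const
  · exact isClosed_iInter fun j => isClosed_eq (continuous_finsetSum _ fun i _ => hc i j)
      continuous_const
  · exact isClosed_iInter fun i => isClosed_iInter fun j => isClosed_iInter fun _ =>
      isClosed_eq (hc i j) continuous_const

theorem continuous_betheObjective (c : Matrix (Fin N) (Fin N) ℝ) :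
    Continuous fun x : ℝ × Matrix (Fin N) (Fin N) ℝ => betheObjective c x.1 x.2 := by
  have hc : ∀ i j, Continuous fun x : ℝ × Matrix (Fin N) (Fin N) ℝ => x.2 i j :=
    fun i j => continuous_snd.matrix_elem i j
  exact continuous_finsetSum _ fun i _ => continuous_finsetSum _ fun j _ =>
    (continuous_fst.mul (continuous_betheTerm.comp (hc i j))).add (continuous_const.mul (hc i j))

theorem exists_isMinOn_betheObjective (hne : (supportedPolytope p).Nonempty)
    (c : Matrix (Fin N) (Fin N) ℝ) (T : ℝ) :
    ∃ β ∈ supportedPolytope p, IsMinOn (betheObjective c T) (supportedPolytope p) β :=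
  isCompact_supportedPolytope.exists_isMinOn hne
    ((continuous_betheObjective c).comp (Continuous.prodMk_right T)).continuousOn

theorem betheObjective_permMatrix (c : Matrix (Fin N) (Fin N) ℝ) (T : ℝ)
    (τ : Equiv.Perm (Fin N)) : betheObjective c T (τ.permMatrix ℝ) = ∑ i, c i (τ i) := by
  refine Finset.sum_congr rfl fun i _ => ?_
  rw [Finset.sum_eq_single (τ i)]
  · rw [permMatrix_apply_eq, if_pos rfl, betheTerm_one]
    ring
  · intro j _ hj
    rw [permMatrix_apply_eq, if_neg hj, betheTerm_zero]
    ring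
  · simp

/-! ### Consequences of full indecomposability -/

theorem mem_positiveCols {R : Finset (Fin N)} {j : Fin N} :
    j ∈ positiveCols p R ↔ ∃ i ∈ R, 0 < p i j := by
  simp [positiveCols]

theorem FullyIndecomposable.card_lt (hind : FullyIndecomposable p) {R : Finset (Fin N)}
    (hR : R.Nonempty) (hR' : R ≠ Finset.univ) : R.card < (positiveCols p R).card := by
  have h := hind R hR hR'
  rwa [show {j : Fin N | ∃ i ∈ R, 0 < p i j} = (positiveCols p R : Set (Fin N)) by
    ext j; simp [mem_positiveCols], Set.ncard_coe_finset] at h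

/-- Hall's theorem with `i₀` forced to `j₀` and `j₀` removed from the other rows; the strict
inequality in full indecomposability pays for the removed column. -/
theorem FullyIndecomposable.exists_perm (hind : FullyIndecomposable p) {i₀ j₀ : Fin N}
    (h₀ : 0 < p i₀ j₀) : ∃ τ : Equiv.Perm (Fin N), τ i₀ = j₀ ∧ ∀ i, 0 < p i (τ i) := by
  classical
  let t : Fin N → Finset (Fin N) := fun i =>
    if i = i₀ then {j₀} else (positiveCols p {i}).erase j₀
  have hall : ∀ s : Finset (Fin N), s.card ≤ (s.biUnion t).card := by
    intro s
    by_cases hi : i₀ ∈ s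
    · rcases (s.erase i₀).eq_empty_or_nonempty with he | he
      · have hc : s.card = 1 := by
          have := Finset.card_erase_add_one hi
          rw [he] at this
          simpa using this.symm
        rw [hc, Nat.one_le_iff_ne_zero, ← Nat.pos_iff_ne_zero, Finset.card_pos]
        exact ⟨j₀, Finset.mem_biUnion.2 ⟨i₀, hi, by simp [t]⟩⟩
      · have h1 := hind.card_lt he fun h => by
          have := Finset.mem_univ i₀
          rw [← h] at this
          simp at this
        rw [← Finset.card_erase_add_one hi]
        refine (Nat.succ_le_of_lt h1).trans (Finset.card_le_card fun j hj => ?_)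
        obtain ⟨i, his, hij⟩ := mem_positiveCols.1 hj
        rw [Finset.mem_biUnion]
        rcases eq_or_ne j j₀ with rfl | hjj
        · exact ⟨i₀, hi, by simp [t]⟩
        · refine ⟨i, Finset.mem_of_mem_erase his, ?_⟩
          simp [t, Finset.ne_of_mem_erase his, mem_positiveCols, hij, hjj]
    · rcases s.eq_empty_or_nonempty with rfl | he
      · simp
      · have h1 := hind.card_lt he fun h => hi (h ▸ Finset.mem_univ i₀)
        refine (Nat.le_sub_one_of_lt h1).trans ((Finset.pred_card_le_card_erase (a := j₀)).trans
          (Finset.card_le_card fun j hj => ?_))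
        obtain ⟨hjj, hj⟩ := Finset.mem_erase.1 hj
        obtain ⟨i, his, hij⟩ := mem_positiveCols.1 hj
        have : i ≠ i₀ := fun h => hi (h ▸ his)
        rw [Finset.mem_biUnion]
        exact ⟨i, his, by simp [t, this, mem_positiveCols, hij, hjj]⟩
  obtain ⟨f, hf, hft⟩ := (Finset.all_card_le_biUnion_card_iff_exists_injective t).1 hall
  have hf0 : f i₀ = j₀ := by simpa [t] using hft i₀
  refine ⟨Equiv.ofBijective f (Finite.injective_iff_bijective.1 hf), hf0, fun i => ?_⟩
  change 0 < p i (f i)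
  rcases eq_or_ne i i₀ with rfl | hi
  · rwa [hf0]
  · have := hft i
    simp only [t, hi, if_false, Finset.mem_erase, mem_positiveCols, Finset.mem_singleton,
      exists_eq_left] at this
    exact this.2

theorem FullyIndecomposable.exists_ne (hind : FullyIndecomposable p) (hN : 2 ≤ N)
    (i j : Fin N) : ∃ j' ≠ j, 0 < p i j' := by
  have h := hind.card_lt (R := {i}) (Finset.singleton_nonempty i) fun h => by
    have := congrArg Finset.card h
    simp at this
    omega
  rw [Finset.card_singleton] at h
  obtain ⟨j', hj', hne⟩ := Finset.exists_mem_ne h j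
  exact ⟨j', hne, by simpa [mem_positiveCols] using hj'⟩

theorem FullyIndecomposable.isInteriorOn_of_pos (hind : FullyIndecomposable p) (hN : 2 ≤ N)
    {β : Matrix (Fin N) (Fin N) ℝ} (hβ : β ∈ doublyStochastic ℝ (Fin N))
    (hpos : ∀ i j, 0 < p i j → 0 < β i j) : IsInteriorOn p β := by
  refine fun i j hij => ⟨hpos i j hij, ?_⟩
  obtain ⟨j', hj', hp'⟩ := hind.exists_ne hN i j
  have := Finset.add_le_sum (f := fun j => β i j) (s := Finset.univ)
    (fun j _ => nonneg_of_mem_doublyStochastic hβ) (Finset.mem_univ j) (Finset.mem_univ j') hj'.symm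
  rw [sum_row_of_mem_doublyStochastic hβ i] at this
  linarith [hpos i j' hp']

theorem FullyIndecomposable.exists_isInteriorOn (hind : FullyIndecomposable p) (hN : 2 ≤ N) :
    ∃ β ∈ supportedPolytope p, IsInteriorOn p β := by
  classical
  let S : Finset (Equiv.Perm (Fin N)) := Finset.univ.filter fun τ => ∀ i, 0 < p i (τ i)
  have hS : ∀ τ, τ ∈ S ↔ ∀ i, 0 < p i (τ i) := fun τ => by simp [S]
  have hne : S.Nonempty := by
    obtain ⟨j, -, hj⟩ := hind.exists_ne hN ⟨0, by omega⟩ ⟨0, by omega⟩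
    obtain ⟨τ, -, hτ⟩ := hind.exists_perm hj
    exact ⟨τ, (hS τ).2 hτ⟩
  have hcard : (0 : ℝ) < S.card := by exact_mod_cast hne.card_pos
  -- The uniform average of all supported permutations is positive on the support, since each
  -- support entry lies on one of them.
  set β := ∑ τ ∈ S, (1 / (S.card : ℝ)) • τ.permMatrix ℝ with hβdef
  have hβ : β ∈ supportedPolytope p :=
    convex_supportedPolytope.sum_mem (fun _ _ => by positivity)
      (by rw [Finset.sum_const, nsmul_eq_mul]; field_simp)
      fun τ hτ => permMatrix_mem_supportedPolytope ((hS τ).1 hτ)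
  refine ⟨β, hβ, hind.isInteriorOn_of_pos hN hβ.1 fun i j hij => ?_⟩
  obtain ⟨τ, hτ, hτp⟩ := hind.exists_perm hij
  rw [hβdef, Matrix.sum_apply]
  refine Finset.sum_pos' (fun τ _ => ?_) ⟨τ, (hS τ).2 hτp, ?_⟩
  · rw [Matrix.smul_apply, permMatrix_apply_eq]
    split_ifs <;> simp
  · rw [Matrix.smul_apply, permMatrix_apply_eq, if_pos hτ.symm]
    simpa using hcard

/-! ### The maximum-likelihood matching -/

theorem IsMLMatching.pos {σ : Equiv.Perm (Fin N)} (hσ : IsMLMatching p σ)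
    (hp : ∀ i j, 0 ≤ p i j) (hN : 2 ≤ N) (i : Fin N) : 0 < p i (σ i) := by
  have : Nontrivial (Fin N) := Fin.nontrivial_iff_two_le.2 hN
  obtain ⟨τ, hτ⟩ := exists_ne σ
  have h := (Finset.prod_nonneg fun i _ => hp i (τ i)).trans_lt (hσ τ hτ)
  exact lt_of_le_of_ne (hp _ _) fun h0 => h.ne' (Finset.prod_eq_zero (Finset.mem_univ i) h0.symm)

theorem IsMLMatching.sum_log_lt {σ τ : Equiv.Perm (Fin N)} (hσ : IsMLMatching p σ)
    (hτ : ∀ i, 0 < p i (τ i)) (hne : τ ≠ σ) :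
    ∑ i, Real.log (p i (τ i)) < ∑ i, Real.log (p i (σ i)) := by
  have hlt := hσ τ hne
  have hτ0 : 0 < ∏ i, p i (τ i) := Finset.prod_pos fun i _ => hτ i
  have hσ0 : ∀ i ∈ Finset.univ, p i (σ i) ≠ 0 := Finset.prod_ne_zero_iff.1 (hτ0.trans hlt).ne'
  rw [← Real.log_prod fun i _ => (hτ i).ne', ← Real.log_prod hσ0]
  exact Real.log_lt_log hτ0 hlt

/-- The linear cost `-∑ β ln p` grows at least linearly away from the maximum-likelihood
matching. -/
theorem IsMLMatching.exists_linear_growth {σ : Equiv.Perm (Fin N)} (hσ : IsMLMatching p σ)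
    (hp : ∀ i j, 0 ≤ p i j) (hN : 2 ≤ N) :
    ∃ k > 0, ∀ β ∈ supportedPolytope p,
      k * ∑ i, (1 - β i (σ i)) ≤
        ∑ i, ∑ j, -Real.log (p i j) * β i j - ∑ i, -Real.log (p i (σ i)) := by
  have hgap : ∀ τ : Equiv.Perm (Fin N), ∃ k > 0, (∀ i, 0 < p i (τ i)) →
      k * ∑ i, (1 - τ.permMatrix ℝ i (σ i)) ≤
        ∑ i, -Real.log (p i (τ i)) - ∑ i, -Real.log (p i (σ i)) := by
    intro τ
    rcases eq_or_ne τ σ with rfl | hτ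
    · exact ⟨1, one_pos, fun _ => by simp⟩
    by_cases hτp : ∀ i, 0 < p i (τ i)
    swap
    · exact ⟨1, one_pos, fun h => absurd h hτp⟩
    have hlog := hσ.sum_log_lt hτp hτ
    have hNpos : (0 : ℝ) < N := by exact_mod_cast (by omega : 0 < N)
    -- At most `N` rows of `τ` differ from `σ`, so the log-likelihood gap is divided by `N`.
    refine ⟨(∑ i, Real.log (p i (σ i)) - ∑ i, Real.log (p i (τ i))) / N,
      div_pos (sub_pos.2 hlog) hNpos, fun _ => ?_⟩
    have hle : ∑ i, (1 - τ.permMatrix ℝ i (σ i)) ≤ (N : ℝ) := by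
      refine (Finset.sum_le_sum (g := fun _ => (1 : ℝ)) fun i _ => ?_).trans (by simp)
      rw [permMatrix_apply_eq]
      split_ifs <;> simp
    refine (mul_le_mul_of_nonneg_left hle (div_pos (sub_pos.2 hlog) hNpos).le).trans ?_
    rw [div_mul_cancel₀ _ hNpos.ne', Finset.sum_neg_distrib, Finset.sum_neg_distrib]
    linarith
  choose k hk0 hk using hgap
  obtain ⟨τ₀, hτ₀⟩ := Finite.exists_min k
  refine ⟨k τ₀, hk0 τ₀, fun β hβ => ?_⟩
  -- Both sides are affine in `β`, so a Birkhoff decomposition reduces the bound to permutations;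
  -- those of positive weight are supported because `β` is.
  obtain ⟨w, hw0, hw1, hwβ⟩ := exists_eq_sum_perm_of_mem_doublyStochastic hβ.1
  have hentry : ∀ i j, β i j = ∑ τ, w τ * τ.permMatrix ℝ i j := by
    intro i j
    rw [← hwβ, Matrix.sum_apply]
    simp
  have hcost : ∑ i, ∑ j, -Real.log (p i j) * β i j =
      ∑ τ, w τ * ∑ i, -Real.log (p i (τ i)) := by
    simp_rw [hentry, Finset.mul_sum]
    rw [Finset.sum_congr rfl fun i _ => Finset.sum_comm, Finset.sum_comm]
    refine Finset.sum_congr rfl fun τ _ => Finset.sum_congr rfl fun i _ => ?_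
    rw [Finset.sum_eq_single (τ i)]
    · rw [permMatrix_apply_eq, if_pos rfl]; ring
    · intro j _ hj
      rw [permMatrix_apply_eq, if_neg hj]; ring
    · simp
  have hdist : ∑ i, (1 - β i (σ i)) = ∑ τ, w τ * ∑ i, (1 - τ.permMatrix ℝ i (σ i)) := by
    simp_rw [hentry, Finset.mul_sum, mul_sub, mul_one]
    rw [Finset.sum_comm]
    refine Finset.sum_congr rfl fun i _ => ?_
    rw [Finset.sum_sub_distrib, hw1]
  have hconst : ∑ i, -Real.log (p i (σ i)) = ∑ τ, w τ * ∑ i, -Real.log (p i (σ i)) := by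
    rw [← Finset.sum_mul, hw1, one_mul]
  rw [hcost, hdist, hconst, Finset.mul_sum, ← Finset.sum_sub_distrib]
  refine Finset.sum_le_sum fun τ _ => ?_
  rw [← mul_sub, mul_left_comm]
  rcases (hw0 τ).eq_or_lt with h | h
  · simp [← h]
  refine mul_le_mul_of_nonneg_left (le_trans ?_ (hk τ fun i => ?_)) h.le
  · refine mul_le_mul_of_nonneg_right (hτ₀ τ) (Finset.sum_nonneg fun i _ => ?_)
    rw [permMatrix_apply_eq]
    split_ifs <;> simp
  · refine lt_of_le_of_ne (hp _ _) fun h0 => ?_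
    have h1 := hβ.2 i (τ i) h0.symm
    rw [hentry] at h1
    have h2 := (Finset.sum_eq_zero_iff_of_nonneg fun τ' _ => mul_nonneg (hw0 τ')
      (nonneg_of_mem_doublyStochastic permMatrix_mem_doublyStochastic)).1 h1 τ (Finset.mem_univ τ)
    rw [permMatrix_apply_eq, if_pos rfl, mul_one] at h2
    exact h.ne' h2

end Polytope

/-! ### Strict convexity of the Bethe objective -/

section Convexity

variable {N : ℕ} {p : Matrix (Fin N) (Fin N) ℝ}

theorem sum_filter_pos_eq_sum {x g : Fin N → ℝ} (hx : ∀ j, 0 ≤ x j) (hg : ∀ j, x j = 0 → g j = 0) :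
    ∑ j with 0 < x j, g j = ∑ j, g j :=
  Finset.sum_filter_of_ne fun j _ hj => lt_of_le_of_ne (hx j) fun h => hj (hg j h.symm)

theorem ncard_pos_le_of_forall_row {k : ℕ}
    (h : ∀ i, (Finset.univ.filter fun j => 0 < p i j).card ≤ k) :
    {e : Fin N × Fin N | 0 < p e.1 e.2}.ncard ≤ k * N := by
  have hset : {e : Fin N × Fin N | 0 < p e.1 e.2} =
      ((Finset.univ.filter fun e : Fin N × Fin N => 0 < p e.1 e.2 : Finset _) : Set _) := by
    ext; simp
  rw [hset, Set.ncard_coe_finset, Finset.card_filter, Fintype.sum_prod_type]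
  simp_rw [← Finset.card_filter]
  exact (Finset.sum_le_sum fun i _ => h i).trans (by simp [mul_comm])

/-- Connectedness of the support: otherwise `R` and its complement would occupy disjoint column
sets, each larger than its row set, giving more than `N` columns. -/
theorem eq_univ_of_closed (hind : FullyIndecomposable p) {R : Finset (Fin N)} (hR : R.Nonempty)
    (hcl : ∀ i ∈ R, ∀ i' j, 0 < p i j → 0 < p i' j → i' ∈ R) : R = Finset.univ := by
  by_contra hne
  have h1 := hind.card_lt hR hne
  have h2 := hind.card_lt (R := Rᶜ)
    (Finset.nonempty_iff_ne_empty.2 fun h => hne (by simpa using h))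
    fun h => hR.ne_empty (by simpa using h)
  have hdisj : Disjoint (positiveCols p R) (positiveCols p Rᶜ) := by
    rw [Finset.disjoint_left]
    intro j hj hj'
    obtain ⟨i, hi, hij⟩ := mem_positiveCols.1 hj
    obtain ⟨i', hi', hij'⟩ := mem_positiveCols.1 hj'
    exact Finset.mem_compl.1 hi' (hcl i hi i' j hij hij')
  have h3 := Finset.card_le_univ (positiveCols p R ∪ positiveCols p Rᶜ)
  rw [Finset.card_union_of_disjoint hdisj] at h3
  have h4 := Finset.card_add_card_compl R
  omega

/-- The second variation of the Bethe free energy is positive definite at interior points. -/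
theorem secondVariation_pos (hp : ∀ i j, 0 ≤ p i j) (hind : FullyIndecomposable p)
    (hcard : 2 * N < {e : Fin N × Fin N | 0 < p e.1 e.2}.ncard)
    {β v : Matrix (Fin N) (Fin N) ℝ} (hβ : β ∈ supportedPolytope p) (hint : IsInteriorOn p β)
    (hrow : ∀ i, ∑ j, v i j = 0) (hcol : ∀ j, ∑ i, v i j = 0)
    (hoff : ∀ i j, p i j = 0 → v i j = 0) (hv : v ≠ 0) :
    0 < ∑ i, ∑ j, v i j ^ 2 * (1 / β i j - 1 / (1 - β i j)) := by
  classical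
  let r : Fin N → Finset (Fin N) := fun i => Finset.univ.filter fun j => 0 < p i j
  let s : Fin N → Finset (Fin N) := fun j => Finset.univ.filter fun i => 0 < p i j
  have mr : ∀ {i j}, j ∈ r i ↔ 0 < p i j := by simp [r]
  have ms : ∀ {i j}, i ∈ s j ↔ 0 < p i j := by simp [s]
  have hrβ : ∀ i, ∑ j ∈ r i, β i j = 1 := fun i =>
    (sum_filter_pos_eq_sum (hp i) (hβ.2 i)).trans (sum_row_of_mem_doublyStochastic hβ.1 i)
  have hsβ : ∀ j, ∑ i ∈ s j, β i j = 1 := fun j =>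
    (sum_filter_pos_eq_sum (fun i => hp i j) (fun i => hβ.2 i j)).trans
      (sum_col_of_mem_doublyStochastic hβ.1 j)
  have hrv : ∀ i, ∑ j ∈ r i, v i j = 0 := fun i =>
    (sum_filter_pos_eq_sum (hp i) (hoff i)).trans (hrow i)
  have hsv : ∀ j, ∑ i ∈ s j, v i j = 0 := fun j =>
    (sum_filter_pos_eq_sum (fun i => hp i j) (fun i => hoff i j)).trans (hcol j)
  have hrq : ∀ i, ∑ j, v i j ^ 2 * (1 / β i j - 1 / (1 - β i j)) =
      ∑ j ∈ r i, v i j ^ 2 * (1 / β i j - 1 / (1 - β i j)) := fun i =>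
    (sum_filter_pos_eq_sum (hp i) fun j hj => by simp [hoff i j hj]).symm
  have hsq : ∀ j, ∑ i, v i j ^ 2 * (1 / β i j - 1 / (1 - β i j)) =
      ∑ i ∈ s j, v i j ^ 2 * (1 / β i j - 1 / (1 - β i j)) := fun j =>
    (sum_filter_pos_eq_sum (fun i => hp i j) fun i hi => by simp [hoff i j hi]).symm
  have hr0 : ∀ i, ∀ j ∈ r i, 0 < β i j := fun i j h => (hint i j (mr.1 h)).1
  have hr1 : ∀ i, ∀ j ∈ r i, β i j < 1 := fun i j h => (hint i j (mr.1 h)).2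
  have hs0 : ∀ j, ∀ i ∈ s j, 0 < β i j := fun j i h => (hint i j (ms.1 h)).1
  have hs1 : ∀ j, ∀ i ∈ s j, β i j < 1 := fun j i h => (hint i j (ms.1 h)).2
  have hrnn : ∀ i, 0 ≤ ∑ j, v i j ^ 2 * (1 / β i j - 1 / (1 - β i j)) := fun i =>
    (hrq i).symm ▸ simplexForm_nonneg (hr0 i) (hr1 i) (hrβ i) (hrv i)
  have hsnn : ∀ j, 0 ≤ ∑ i, v i j ^ 2 * (1 / β i j - 1 / (1 - β i j)) := fun j =>
    (hsq j).symm ▸ simplexForm_nonneg (hs0 j) (hs1 j) (hsβ j) (hsv j)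
  refine lt_of_le_of_ne (Finset.sum_nonneg fun i _ => hrnn i) fun hzero => ?_
  have hrz : ∀ i, ∑ j ∈ r i, v i j ^ 2 * (1 / β i j - 1 / (1 - β i j)) = 0 := fun i =>
    (hrq i).symm.trans ((Finset.sum_eq_zero_iff_of_nonneg fun i _ => hrnn i).1 hzero.symm i
      (Finset.mem_univ i))
  have hsz : ∀ j, ∑ i ∈ s j, v i j ^ 2 * (1 / β i j - 1 / (1 - β i j)) = 0 := fun j => by
    rw [Finset.sum_comm] at hzero
    exact (hsq j).symm.trans ((Finset.sum_eq_zero_iff_of_nonneg fun j _ => hsnn j).1 hzero.symm j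
      (Finset.mem_univ j))
  have hpos : ∀ {i j}, v i j ≠ 0 → 0 < p i j := fun {i j} h =>
    lt_of_le_of_ne (hp i j) fun h0 => h (hoff i j h0.symm)
  -- In the equality case a nonzero entry makes its whole row and column nonzero on the support. By
  -- connectedness this reaches every row, so each row has at most two support entries, against
  -- `hcard`.
  let R : Finset (Fin N) := Finset.univ.filter fun i => ∃ j, v i j ≠ 0
  have mR : ∀ {i}, i ∈ R ↔ ∃ j, v i j ≠ 0 := by simp [R]
  have hRuniv : R = Finset.univ := by
    refine eq_univ_of_closed hind ?_ fun i hi i' j hij hij' => ?_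
    · by_contra hR
      refine hv (Matrix.ext fun i j => ?_)
      by_contra h
      exact hR ⟨i, mR.2 ⟨j, h⟩⟩
    · obtain ⟨k, hk⟩ := mR.1 hi
      have h1 : v i j ≠ 0 := ne_zero_of_simplexForm_eq_zero (hr0 i) (hr1 i) (hrβ i) (hrv i) (hrz i)
        (mr.2 (hpos hk)) hk (mr.2 hij)
      exact mR.2 ⟨j, ne_zero_of_simplexForm_eq_zero (v := fun i => v i j) (hs0 j) (hs1 j) (hsβ j)
        (hsv j) (hsz j) (ms.2 hij) h1 (ms.2 hij')⟩
  refine hcard.not_ge (ncard_pos_le_of_forall_row fun i => ?_)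
  obtain ⟨k, hk⟩ := mR.1 (hRuniv ▸ Finset.mem_univ i)
  exact card_le_two_of_simplexForm_eq_zero (hr0 i) (hr1 i) (hrβ i) (hrv i) (hrz i)
    (mr.2 (hpos hk)) hk

/-- The directional derivative of the Bethe objective. -/
noncomputable def betheSlope (c : Matrix (Fin N) (Fin N) ℝ) (T : ℝ)
    (β v : Matrix (Fin N) (Fin N) ℝ) : ℝ :=
  ∑ i, ∑ j, v i j * (T * (Real.log (β i j) + Real.log (1 - β i j) + 2) + c i j)

theorem hasDerivAt_betheObjective (hp : ∀ i j, 0 ≤ p i j) {c : Matrix (Fin N) (Fin N) ℝ} {T t : ℝ}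
    {β v : Matrix (Fin N) (Fin N) ℝ} (hoff : ∀ i j, p i j = 0 → v i j = 0)
    (hint : IsInteriorOn p (β + t • v)) :
    HasDerivAt (fun t => betheObjective c T (β + t • v)) (betheSlope c T (β + t • v) v) t := by
  refine HasDerivAt.fun_sum fun i _ => HasDerivAt.fun_sum fun j _ => ?_
  simp only [Matrix.add_apply, Matrix.smul_apply, smul_eq_mul]
  rcases (hp i j).eq_or_lt with h | h
  · simpa [hoff i j h.symm] using hasDerivAt_const t (T * betheTerm (β i j) + c i j * β i j)
  · have hlin : HasDerivAt (fun t : ℝ => β i j + t * v i j) (v i j) t := by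
      simpa using ((hasDerivAt_id t).mul_const (v i j)).const_add (β i j)
    have hx := hint i j h
    simp only [Matrix.add_apply, Matrix.smul_apply, smul_eq_mul] at hx
    have hf := (hasDerivAt_betheTerm hx.1 hx.2).comp t hlin
    exact ((hf.const_mul T).add (hlin.const_mul (c i j))).congr_deriv (by ring)

theorem hasDerivAt_betheSlope (hp : ∀ i j, 0 ≤ p i j) {c : Matrix (Fin N) (Fin N) ℝ} {T t : ℝ}
    {β v : Matrix (Fin N) (Fin N) ℝ} (hoff : ∀ i j, p i j = 0 → v i j = 0)
    (hint : IsInteriorOn p (β + t • v)) :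
    HasDerivAt (fun t => betheSlope c T (β + t • v) v)
      (T * ∑ i, ∑ j, v i j ^ 2 * (1 / (β + t • v) i j - 1 / (1 - (β + t • v) i j))) t := by
  simp_rw [Finset.mul_sum]
  refine HasDerivAt.fun_sum fun i _ => HasDerivAt.fun_sum fun j _ => ?_
  simp only [Matrix.add_apply, Matrix.smul_apply, smul_eq_mul]
  rcases (hp i j).eq_or_lt with h | h
  · simpa [hoff i j h.symm] using hasDerivAt_const t (0 : ℝ)
  · have hlin : HasDerivAt (fun t : ℝ => β i j + t * v i j) (v i j) t := by
      simpa using ((hasDerivAt_id t).mul_const (v i j)).const_add (β i j)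
    have hx := hint i j h
    simp only [Matrix.add_apply, Matrix.smul_apply, smul_eq_mul] at hx
    have h1 := hlin.log hx.1.ne'
    have h2 := (hlin.const_sub 1).log (sub_pos.2 hx.2).ne'
    exact (((((h1.add h2).add_const 2).const_mul T).add_const (c i j)).const_mul
      (v i j)).congr_deriv (by ring)

/-- Only `β` has to be interior: the open segment is then interior, and `γ` may be a permutation
matrix. -/
theorem strictConvexOn_segment (hp : ∀ i j, 0 ≤ p i j) (hind : FullyIndecomposable p)
    (hcard : 2 * N < {e : Fin N × Fin N | 0 < p e.1 e.2}.ncard)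
    (c : Matrix (Fin N) (Fin N) ℝ) {T : ℝ} (hT : 0 < T)
    {β γ : Matrix (Fin N) (Fin N) ℝ} (hβ : β ∈ supportedPolytope p) (hint : IsInteriorOn p β)
    (hγ : γ ∈ supportedPolytope p) (hne : γ ≠ β) :
    StrictConvexOn ℝ (Set.Icc 0 1) fun t : ℝ => betheObjective c T (β + t • (γ - β)) := by
  set v := γ - β with hv
  have hoff : ∀ i j, p i j = 0 → v i j = 0 := fun i j h => by
    simp [hv, hβ.2 i j h, hγ.2 i j h]
  have hmem : ∀ t ∈ Set.Ioo (0 : ℝ) 1, β + t • v ∈ supportedPolytope p := fun t ht =>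
    convex_supportedPolytope.add_smul_sub_mem hβ hγ ⟨ht.1.le, ht.2.le⟩
  have hin : ∀ t ∈ Set.Ioo (0 : ℝ) 1, IsInteriorOn p (β + t • v) := by
    intro t ht i j hij
    have h := hint i j hij
    have h0 : 0 ≤ γ i j := nonneg_of_mem_doublyStochastic hγ.1
    have h1 : γ i j ≤ 1 := le_one_of_mem_doublyStochastic hγ.1
    simp only [hv, Matrix.add_apply, Matrix.smul_apply, Matrix.sub_apply, smul_eq_mul]
    constructor <;> nlinarith [ht.1, ht.2, h.1, h.2]
  have hcont : Continuous fun t : ℝ => betheObjective c T (β + t • v) :=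
    (continuous_betheObjective c).comp
      (continuous_const.prodMk (continuous_const.add (continuous_id.smul continuous_const)))
  refine StrictMonoOn.strictConvexOn_of_deriv (convex_Icc 0 1) hcont.continuousOn ?_
  rw [interior_Icc]
  have hmono : StrictMonoOn (fun t : ℝ => betheSlope c T (β + t • v) v) (Set.Ioo 0 1) := by
    refine strictMonoOn_of_deriv_pos (convex_Ioo 0 1)
      (fun t ht => (hasDerivAt_betheSlope hp hoff (hin t ht)).continuousAt.continuousWithinAt)
      fun t ht => ?_
    rw [interior_Ioo] at ht
    rw [(hasDerivAt_betheSlope hp hoff (hin t ht)).deriv]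
    refine mul_pos hT (secondVariation_pos hp hind hcard (hmem t ht) (hin t ht) (fun i => ?_)
      (fun j => ?_) hoff (sub_ne_zero.2 hne))
    · simp [hv, Finset.sum_sub_distrib, sum_row_of_mem_doublyStochastic hβ.1,
        sum_row_of_mem_doublyStochastic hγ.1]
    · simp [hv, Finset.sum_sub_distrib, sum_col_of_mem_doublyStochastic hβ.1,
        sum_col_of_mem_doublyStochastic hγ.1]
  exact hmono.congr fun t ht => (hasDerivAt_betheObjective hp hoff (hin t ht)).deriv.symm

theorem eq_of_isMinOn_of_isInteriorOn (hp : ∀ i j, 0 ≤ p i j) (hind : FullyIndecomposable p)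
    (hcard : 2 * N < {e : Fin N × Fin N | 0 < p e.1 e.2}.ncard)
    {c : Matrix (Fin N) (Fin N) ℝ} {T : ℝ} (hT : 0 < T)
    {β γ : Matrix (Fin N) (Fin N) ℝ} (hβ : β ∈ supportedPolytope p) (hint : IsInteriorOn p β)
    (hmin : IsMinOn (betheObjective c T) (supportedPolytope p) β) (hγ : γ ∈ supportedPolytope p)
    (hle : betheObjective c T γ ≤ betheObjective c T β) : γ = β := by
  by_contra hne
  have h := (strictConvexOn_segment hp hind hcard c hT hβ hint hγ hne).2
    (Set.left_mem_Icc.2 zero_le_one) (Set.right_mem_Icc.2 zero_le_one) zero_ne_one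
    (half_pos one_pos) (half_pos one_pos) (add_halves 1)
  have hmem := convex_supportedPolytope.add_smul_sub_mem hβ hγ (t := 1 / 2) (by norm_num)
  have hm := isMinOn_iff.1 hmin _ hmem
  simp only [smul_eq_mul, mul_zero, mul_one, zero_add, zero_smul, add_zero, one_smul,
    add_sub_cancel] at h
  linarith

theorem betheObjective_lt_of_betheSlope_eq_zero (hp : ∀ i j, 0 ≤ p i j)
    (hind : FullyIndecomposable p)
    (hcard : 2 * N < {e : Fin N × Fin N | 0 < p e.1 e.2}.ncard)
    {c : Matrix (Fin N) (Fin N) ℝ} {T : ℝ} (hT : 0 < T)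
    {β γ : Matrix (Fin N) (Fin N) ℝ} (hβ : β ∈ supportedPolytope p) (hint : IsInteriorOn p β)
    (hγ : γ ∈ supportedPolytope p) (hne : γ ≠ β) (hslope : betheSlope c T β (γ - β) = 0) :
    betheObjective c T β < betheObjective c T γ := by
  have hoff : ∀ i j, p i j = 0 → (γ - β) i j = 0 := fun i j h => by
    simp [hβ.2 i j h, hγ.2 i j h]
  have hd := hasDerivAt_betheObjective (c := c) (T := T) (t := 0) (β := β) hp hoff (by simpa)
  have h := (strictConvexOn_segment hp hind hcard c hT hβ hint hγ hne).lt_slope_of_hasDerivAt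
    (Set.left_mem_Icc.2 zero_le_one) (Set.right_mem_Icc.2 zero_le_one) one_pos hd
  simpa [slope_def_field, hslope] using h

end Convexity

/-! ### Minimizers are interior points or permutation matrices -/

section Minimizers

variable {N : ℕ} {p : Matrix (Fin N) (Fin N) ℝ}

/-- If the sum `κ` were positive, the negative term `T κ t ln t` would dominate the `O(t)`
remainder, and moving towards `γ` would lower the objective. -/
theorem sum_endpointSlope_nonpos {c : Matrix (Fin N) (Fin N) ℝ} {T : ℝ} (hT : 0 < T)
    {β γ : Matrix (Fin N) (Fin N) ℝ} (hβ : β ∈ supportedPolytope p)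
    (hmin : IsMinOn (betheObjective c T) (supportedPolytope p) β) (hγ : γ ∈ supportedPolytope p) :
    ∑ i, ∑ j, endpointSlope (β i j) (γ i j - β i j) ≤ 0 := by
  have hex : ∀ i j, ∃ C, ∀ᶠ t in nhdsWithin (0 : ℝ) (Set.Ioi 0),
      betheTerm (β i j + t * (γ i j - β i j)) - betheTerm (β i j) ≤
        endpointSlope (β i j) (γ i j - β i j) * (t * Real.log t) + C * t := fun i j =>
    exists_betheTerm_sub_le (nonneg_of_mem_doublyStochastic hβ.1)
      (le_one_of_mem_doublyStochastic hβ.1)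
      (by rw [add_sub_cancel]; exact nonneg_of_mem_doublyStochastic hγ.1)
      (by rw [add_sub_cancel]; exact le_one_of_mem_doublyStochastic hγ.1)
  choose C hC using hex
  set κ := ∑ i, ∑ j, endpointSlope (β i j) (γ i j - β i j) with hκ
  set D := ∑ i, ∑ j, (T * C i j + c i j * (γ i j - β i j)) with hD
  by_contra! hpos
  have hlog : ∀ᶠ t in nhdsWithin (0 : ℝ) (Set.Ioi 0), Real.log t < -D / (T * κ) :=
    Real.tendsto_log_nhdsGT_zero.eventually_lt_atBot _
  have hall : ∀ᶠ t in nhdsWithin (0 : ℝ) (Set.Ioi 0), ∀ i j,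
      betheTerm (β i j + t * (γ i j - β i j)) - betheTerm (β i j) ≤
        endpointSlope (β i j) (γ i j - β i j) * (t * Real.log t) + C i j * t :=
    Filter.eventually_all.2 fun i => Filter.eventually_all.2 fun j => hC i j
  obtain ⟨t, ht, hl, hsmall⟩ := (hall.and (hlog.and (Ioo_mem_nhdsGT one_pos))).exists
  have hmem := convex_supportedPolytope.add_smul_sub_mem hβ hγ ⟨hsmall.1.le, hsmall.2.le⟩
  have h1 := isMinOn_iff.1 hmin _ hmem
  have h2 : betheObjective c T (β + t • (γ - β)) - betheObjective c T β ≤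
      T * κ * (t * Real.log t) + D * t := by
    simp only [betheObjective, hκ, hD, Finset.mul_sum, Finset.sum_mul, ← Finset.sum_sub_distrib,
      ← Finset.sum_add_distrib]
    refine Finset.sum_le_sum fun i _ => Finset.sum_le_sum fun j _ => ?_
    simp only [Matrix.add_apply, Matrix.smul_apply, Matrix.sub_apply, smul_eq_mul]
    have := mul_le_mul_of_nonneg_left (ht i j) hT.le
    linarith
  have hTκ := mul_pos hT hpos
  rw [lt_div_iff₀ hTκ] at hl
  have h3 : (Real.log t * (T * κ) + D) * t < 0 :=
    mul_neg_of_neg_of_pos (by linarith) hsmall.1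
  linarith

theorem eq_zero_of_eq_one {β : Matrix (Fin N) (Fin N) ℝ} (hβ : β ∈ doublyStochastic ℝ (Fin N))
    {i j k : Fin N} (hk : β i k = 1) (hjk : j ≠ k) : β i j = 0 := by
  have := Finset.add_le_sum (f := fun j => β i j) (s := Finset.univ)
    (fun j _ => nonneg_of_mem_doublyStochastic hβ) (Finset.mem_univ j) (Finset.mem_univ k) hjk
  rw [sum_row_of_mem_doublyStochastic hβ i, hk] at this
  exact le_antisymm (by linarith) (nonneg_of_mem_doublyStochastic hβ)

theorem eq_zero_of_eq_one' {β : Matrix (Fin N) (Fin N) ℝ} (hβ : β ∈ doublyStochastic ℝ (Fin N))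
    {i j k : Fin N} (hk : β k j = 1) (hik : i ≠ k) : β i j = 0 :=
  eq_zero_of_eq_one (β := β.transpose) (transpose_mem_doublyStochastic_iff.2 hβ) hk hik

/-- Test against an interior `γ`. A row containing a `1` has total slope zero; any other row
contributes `γ i j ≥ 0` at its zeros, strictly positive at a zero on the support. -/
theorem pos_of_isMinOn_of_row_ne_one (hind : FullyIndecomposable p) (hN : 2 ≤ N)
    {c : Matrix (Fin N) (Fin N) ℝ} {T : ℝ} (hT : 0 < T)
    {β : Matrix (Fin N) (Fin N) ℝ} (hβ : β ∈ supportedPolytope p)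
    (hmin : IsMinOn (betheObjective c T) (supportedPolytope p) β) {i : Fin N}
    (hi : ∀ j, β i j ≠ 1) {j : Fin N} (hij : 0 < p i j) : 0 < β i j := by
  obtain ⟨γ, hγ, hγint⟩ := hind.exists_isInteriorOn hN
  have hsum := sum_endpointSlope_nonpos hT hβ hmin hγ
  have hterm : ∀ i, (∀ j, β i j ≠ 1) → ∀ j, 0 ≤ endpointSlope (β i j) (γ i j - β i j) := by
    intro i hi j
    simp only [endpointSlope, hi j, or_false]
    split_ifs with h
    · rw [h, sub_zero]
      exact nonneg_of_mem_doublyStochastic hγ.1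
    · exact le_rfl
  have hrow : ∀ i, 0 ≤ ∑ j, endpointSlope (β i j) (γ i j - β i j) := by
    intro i
    by_cases hi : ∀ j, β i j ≠ 1
    · exact Finset.sum_nonneg fun j _ => hterm i hi j
    · push Not at hi
      obtain ⟨k, hk⟩ := hi
      have : ∀ j, endpointSlope (β i j) (γ i j - β i j) = γ i j - β i j := by
        intro j
        rw [endpointSlope, if_pos]
        rcases eq_or_ne j k with rfl | hjk
        · exact Or.inr hk
        · exact Or.inl (eq_zero_of_eq_one hβ.1 hk hjk)
      simp [this, Finset.sum_sub_distrib, sum_row_of_mem_doublyStochastic hβ.1,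
        sum_row_of_mem_doublyStochastic hγ.1]
  refine lt_of_le_of_ne (nonneg_of_mem_doublyStochastic hβ.1) fun h0 => hsum.not_gt ?_
  refine Finset.sum_pos' (fun i _ => hrow i) ⟨i, Finset.mem_univ i, ?_⟩
  refine Finset.sum_pos' (fun j _ => hterm i hi j) ⟨j, Finset.mem_univ j, ?_⟩
  simpa [endpointSlope, ← h0] using (hγint i j hij).1

/-- A minimizer of the Bethe objective is an interior point or a permutation matrix. -/
theorem isInteriorOn_or_eq_permMatrix (hp : ∀ i j, 0 ≤ p i j) (hind : FullyIndecomposable p)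
    (hN : 2 ≤ N) {c : Matrix (Fin N) (Fin N) ℝ} {T : ℝ} (hT : 0 < T)
    {β : Matrix (Fin N) (Fin N) ℝ} (hβ : β ∈ supportedPolytope p)
    (hmin : IsMinOn (betheObjective c T) (supportedPolytope p) β) :
    IsInteriorOn p β ∨
      ∃ τ : Equiv.Perm (Fin N), (∀ i, 0 < p i (τ i)) ∧ β = τ.permMatrix ℝ := by
  classical
  let R : Finset (Fin N) := Finset.univ.filter fun i => ∀ j, β i j ≠ 1
  have mR : ∀ {i}, i ∈ R ↔ ∀ j, β i j ≠ 1 := by simp [R]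
  have hpos : ∀ {i j}, i ∈ R → 0 < p i j → 0 < β i j := fun hi hij =>
    pos_of_isMinOn_of_row_ne_one hind hN hT hβ hmin (mR.1 hi) hij
  have hone : ∀ i, i ∉ R → ∃ j, β i j = 1 := fun i hi => by
    by_contra! h
    exact hi (mR.2 h)
  rcases R.eq_empty_or_nonempty with hR | hR
  · right
    have : ∀ i, ∃ j, β i j = 1 := fun i => hone i (by simp [hR])
    choose f hf using this
    have hinj : Function.Injective f := fun i k hik => by
      by_contra hne
      have := eq_zero_of_eq_one' hβ.1 (hf k) hne
      rw [← hik, hf i] at this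
      exact one_ne_zero this
    refine ⟨Equiv.ofBijective f (Finite.injective_iff_bijective.1 hinj), fun i => ?_, ?_⟩
    · refine lt_of_le_of_ne (hp _ _) fun h0 => ?_
      have h1 : β i (f i) = 0 := hβ.2 _ _ h0.symm
      rw [hf i] at h1
      exact one_ne_zero h1
    · ext i j
      rw [permMatrix_apply_eq, Equiv.ofBijective_apply]
      split_ifs with h
      · rw [h, hf i]
      · exact eq_zero_of_eq_one hβ.1 (hf i) h
  · left
    by_cases hRu : R = Finset.univ
    · exact hind.isInteriorOn_of_pos hN hβ.1 fun i j => hpos (hRu ▸ Finset.mem_univ i)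
    exfalso
    have h1 := hind.card_lt hR hRu
    have : ∀ i : Fin N, ∃ j, i ∉ R → β i j = 1 := fun i => by
      by_cases hi : i ∈ R
      · exact ⟨i, fun h => absurd hi h⟩
      · exact (hone i hi).imp fun j hj _ => hj
    choose f hf using this
    -- A row outside `R` fills its column with a `1`, whereas `β` is positive on the support of `R`;
    -- such columns therefore avoid `positiveCols p R`, which leaves `R` too few columns.
    have hle : Rᶜ.card ≤ (positiveCols p R)ᶜ.card := by
      refine Finset.card_le_card_of_injOn f (fun i hi => ?_) fun i hi k hk hik => ?_
      · have hi' : i ∉ R := by simpa using hi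
        simp only [Finset.coe_compl, Set.mem_compl_iff, Finset.mem_coe]
        intro hmem
        obtain ⟨k, hk, hpk⟩ := mem_positiveCols.1 hmem
        have hne : k ≠ i := fun h => hi' (h ▸ hk)
        exact (hpos hk hpk).ne' (eq_zero_of_eq_one' hβ.1 (hf i hi') hne)
      · have hi' : i ∉ R := by simpa using hi
        have hk' : k ∉ R := by simpa using hk
        by_contra hne
        have := eq_zero_of_eq_one' hβ.1 (hf k hk') hne
        rw [← hik, hf i hi'] at this
        exact one_ne_zero this
    have h2 := Finset.card_add_card_compl R
    have h3 := Finset.card_add_card_compl (positiveCols p R)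
    omega

/-- The Bethe entropy is positive somewhere, because the support has more than `2N` entries. -/
theorem exists_sum_betheTerm_neg (hp : ∀ i j, 0 ≤ p i j) (hind : FullyIndecomposable p)
    (hN : 2 ≤ N) (hcard : 2 * N < {e : Fin N × Fin N | 0 < p e.1 e.2}.ncard) :
    ∃ β ∈ supportedPolytope p, ∑ i, ∑ j, betheTerm (β i j) < 0 := by
  classical
  have hobj : ∀ β, betheObjective (0 : Matrix (Fin N) (Fin N) ℝ) 1 β =
      ∑ i, ∑ j, betheTerm (β i j) := fun β => by simp [betheObjective]
  obtain ⟨j₁, -, h₁⟩ := hind.exists_ne hN ⟨0, by omega⟩ ⟨0, by omega⟩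
  obtain ⟨j₂, hne, h₂⟩ := hind.exists_ne hN ⟨0, by omega⟩ j₁
  obtain ⟨τ₁, hτ₁, hp₁⟩ := hind.exists_perm h₁
  obtain ⟨τ₂, hτ₂, hp₂⟩ := hind.exists_perm h₂
  by_contra! hall
  -- The entries of this midpoint are `0`, `1/2` or `1`, so its entropy sum is zero. If the sum were
  -- nowhere negative, `μ` would be a minimizer, yet it has an entry `1/2` and cannot be interior
  -- with at most two nonzero entries per row.
  set μ := τ₁.permMatrix ℝ + (1 / 2 : ℝ) • (τ₂.permMatrix ℝ - τ₁.permMatrix ℝ) with hμdef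
  have hμ : μ ∈ supportedPolytope p := convex_supportedPolytope.add_smul_sub_mem
    (permMatrix_mem_supportedPolytope hp₁) (permMatrix_mem_supportedPolytope hp₂) (by norm_num)
  have hentry : ∀ i j, μ i j = (if j = τ₁ i then 1 else 0) + 1 / 2 *
      ((if j = τ₂ i then 1 else 0) - (if j = τ₁ i then 1 else 0)) := fun i j => by
    simp only [hμdef, Matrix.add_apply, Matrix.smul_apply, Matrix.sub_apply, permMatrix_apply_eq,
      smul_eq_mul]
  have hzero : ∑ i, ∑ j, betheTerm (μ i j) = 0 := by
    refine Finset.sum_eq_zero fun i _ => Finset.sum_eq_zero fun j _ => ?_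
    rw [hentry]
    split_ifs
    · norm_num [betheTerm_one]
    · exact (congrArg betheTerm (by norm_num)).trans betheTerm_half_eq_zero
    · exact (congrArg betheTerm (by norm_num)).trans betheTerm_half_eq_zero
    · norm_num [betheTerm_zero]
  have hmin : IsMinOn (betheObjective 0 1) (supportedPolytope p) μ := by
    refine isMinOn_iff.2 fun β hβ => ?_
    rw [hobj, hobj, hzero]
    exact hall β hβ
  rcases isInteriorOn_or_eq_permMatrix hp hind hN one_pos hμ hmin with hint | ⟨τ, -, hτ⟩
  · refine hcard.not_ge (ncard_pos_le_of_forall_row fun i => ?_)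
    refine (Finset.card_le_card (t := {τ₁ i, τ₂ i}) fun j hj => ?_).trans Finset.card_le_two
    have h := (hint i j (by simpa using hj)).1
    rw [hentry] at h
    by_contra hnot
    simp only [Finset.mem_insert, Finset.mem_singleton, not_or] at hnot
    simp [hnot.1, hnot.2] at h
  · have h1 := hentry ⟨0, by omega⟩ j₁
    rw [hτ, permMatrix_apply_eq, hτ₁, hτ₂, if_pos rfl, if_neg hne.symm] at h1
    split_ifs at h1 <;> norm_num at h1

/-! ### Lagrange multipliers -/

/-- Linear duality: a functional vanishing on the common kernel of the constraints is a combination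
of them. The support constraints act only where `p` vanishes, so on the support only row and column
multipliers remain. -/
theorem exists_multipliers {g : Matrix (Fin N) (Fin N) ℝ}
    (h : ∀ v : Matrix (Fin N) (Fin N) ℝ, (∀ i, ∑ j, v i j = 0) → (∀ j, ∑ i, v i j = 0) →
      (∀ i j, p i j = 0 → v i j = 0) → ∑ i, ∑ j, v i j * g i j = 0) :
    ∃ μ ν : Fin N → ℝ, ∀ i j, 0 < p i j → g i j = μ i + ν j := by
  classical
  let entry : Fin N → Fin N → Matrix (Fin N) (Fin N) ℝ →ₗ[ℝ] ℝ := fun i j =>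
    Matrix.entryLinearMap ℝ ℝ i j
  let L : Fin N ⊕ Fin N ⊕ Fin N × Fin N → Matrix (Fin N) (Fin N) ℝ →ₗ[ℝ] ℝ :=
    Sum.elim (fun i => ∑ j, entry i j) (Sum.elim (fun j => ∑ i, entry i j)
      fun e => if p e.1 e.2 = 0 then entry e.1 e.2 else 0)
  let K : Matrix (Fin N) (Fin N) ℝ →ₗ[ℝ] ℝ := ∑ i, ∑ j, g i j • entry i j
  have hK : ⨅ i, (L i).ker ≤ K.ker := by
    intro v hv
    rw [Submodule.mem_iInf] at hv
    have := h v (fun i => by simpa [L, entry] using hv (Sum.inl i))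
      (fun j => by simpa [L, entry] using hv (Sum.inr (Sum.inl j)))
      (fun i j hij => by simpa [L, entry, hij] using hv (Sum.inr (Sum.inr (i, j))))
    rw [LinearMap.mem_ker, ← this]
    simp [K, entry, mul_comm]
  obtain ⟨a, ha⟩ := (Submodule.mem_span_range_iff_exists_fun ℝ).1 (mem_span_of_iInf_ker_le_ker hK)
  refine ⟨fun i => a (Sum.inl i), fun j => a (Sum.inr (Sum.inl j)), fun i j hij => ?_⟩
  have := LinearMap.congr_fun ha (Matrix.single i j 1)
  have hKe : K (Matrix.single i j 1) = g i j := by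
    simp only [K, entry, LinearMap.sum_apply, LinearMap.smul_apply, Matrix.entryLinearMap_apply,
      smul_eq_mul]
    rw [Finset.sum_eq_single i, Finset.sum_eq_single j] <;>
      simp +contextual [Matrix.single_apply, eq_comm]
  have hrow : ∀ k, (∑ l, entry k l) (Matrix.single i j 1) = if k = i then 1 else 0 := fun k => by
    simp only [entry, LinearMap.sum_apply, Matrix.entryLinearMap_apply, Matrix.single_apply]
    by_cases hk : k = i <;> simp [hk, eq_comm (a := i)]
  have hcol : ∀ l, (∑ k, entry k l) (Matrix.single i j 1) = if l = j then 1 else 0 := fun l => by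
    simp only [entry, LinearMap.sum_apply, Matrix.entryLinearMap_apply, Matrix.single_apply]
    by_cases hk : l = j <;> simp [hk, eq_comm (a := j)]
  have hent : ∀ e : Fin N × Fin N, (if p e.1 e.2 = 0 then entry e.1 e.2 else 0)
      (Matrix.single i j 1) = 0 := fun e => by
    split_ifs with he
    · simp only [entry, Matrix.entryLinearMap_apply, Matrix.single_apply]
      rw [if_neg]
      rintro ⟨rfl, rfl⟩
      exact hij.ne' he
    · rfl
  rw [hKe, LinearMap.sum_apply, Fintype.sum_sum_type, Fintype.sum_sum_type] at this
  simp only [L, LinearMap.smul_apply, Sum.elim_inl, Sum.elim_inr, hrow, hcol, hent, smul_eq_mul, mul_ite, mul_one, mul_zero, Finset.sum_ite_eq',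
    Finset.mem_univ, if_true, Finset.sum_const_zero, add_zero] at this
  exact this.symm

theorem betheSlope_eq_zero_of_isMinOn (hp : ∀ i j, 0 ≤ p i j)
    {c : Matrix (Fin N) (Fin N) ℝ} {T : ℝ} {β : Matrix (Fin N) (Fin N) ℝ}
    (hβ : β ∈ supportedPolytope p) (hint : IsInteriorOn p β)
    (hmin : IsMinOn (betheObjective c T) (supportedPolytope p) β)
    {v : Matrix (Fin N) (Fin N) ℝ} (hrow : ∀ i, ∑ j, v i j = 0) (hcol : ∀ j, ∑ i, v i j = 0)
    (hoff : ∀ i j, p i j = 0 → v i j = 0) : betheSlope c T β v = 0 := by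
  have hd := hasDerivAt_betheObjective (c := c) (T := T) (t := 0) (β := β) hp hoff (by simpa)
  have hnn : ∀ᶠ t in nhds (0 : ℝ), ∀ i j, 0 ≤ β i j + t * v i j := by
    refine Filter.eventually_all.2 fun i => Filter.eventually_all.2 fun j => ?_
    rcases (hp i j).eq_or_lt with h | h
    · simp [hβ.2 i j h.symm, hoff i j h.symm]
    · have hc : Continuous fun t : ℝ => β i j + t * v i j := by fun_prop
      have h0 : 0 < β i j + 0 * v i j := by simpa using (hint i j h).1
      exact (hc.continuousAt.eventually (lt_mem_nhds h0)).mono fun t => le_of_lt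
  have hloc : IsLocalMin (fun t : ℝ => betheObjective c T (β + t • v)) 0 := by
    filter_upwards [hnn] with t ht
    simp only [zero_smul, add_zero]
    refine isMinOn_iff.1 hmin _ ⟨mem_doublyStochastic_iff_sum.2 ⟨fun i j => ?_, fun i => ?_,
      fun j => ?_⟩, fun i j hij => ?_⟩
    · simpa using ht i j
    · simp [Finset.sum_add_distrib, ← Finset.mul_sum, hrow i,
        sum_row_of_mem_doublyStochastic hβ.1]
    · simp [Finset.sum_add_distrib, ← Finset.mul_sum, hcol j,
        sum_col_of_mem_doublyStochastic hβ.1]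
    · simp [hβ.2 i j hij, hoff i j hij]
  have := hloc.hasDerivAt_eq_zero hd
  simpa using this

end Minimizers

/-! ### Belief-propagation solutions as critical points -/

section BeliefPropagation

variable {N : ℕ} {p : Matrix (Fin N) (Fin N) ℝ}

/-- The linear cost `-ln p`. -/
noncomputable def logCost {N : ℕ} (p : Matrix (Fin N) (Fin N) ℝ) : Matrix (Fin N) (Fin N) ℝ :=
  Matrix.of fun i j => -Real.log (p i j)

theorem betheObjective_eq_add (c : Matrix (Fin N) (Fin N) ℝ) (T : ℝ)
    (β : Matrix (Fin N) (Fin N) ℝ) :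
    betheObjective c T β = T * ∑ i, ∑ j, betheTerm (β i j) + ∑ i, ∑ j, c i j * β i j := by
  simp only [betheObjective, Finset.sum_add_distrib, Finset.mul_sum]

theorem betheFreeEnergy_eq_betheObjective (hp : ∀ i j, 0 ≤ p i j) {T : ℝ} (hT : 0 < T)
    {β : Matrix (Fin N) (Fin N) ℝ} (hβ : β ∈ supportedPolytope p) :
    betheFreeEnergy p T β = (betheObjective (logCost p) T β : EReal) := by
  rw [betheFreeEnergy, if_neg]
  swap
  · rintro ⟨i, j, hij, h⟩
    exact h (hβ.2 i j hij)
  congr 1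
  simp only [betheObjective, Finset.mul_sum, betheTerm, logCost, Matrix.of_apply, thermalMatrix]
  refine Finset.sum_congr rfl fun i _ => Finset.sum_congr rfl fun j _ => ?_
  rcases eq_or_ne (β i j) 0 with h | h
  · simp [h]
  · have hpij : 0 < p i j := lt_of_le_of_ne (hp i j) fun h0 => h (hβ.2 i j h0.symm)
    rw [Real.log_div h (Real.rpow_pos_of_pos hpij _).ne', Real.log_rpow hpij]
    field_simp
    ring

theorem betheFreeEnergy_eq_top {T : ℝ} {β : Matrix (Fin N) (Fin N) ℝ}
    (hβ : β ∈ doublyStochastic ℝ (Fin N)) (hnot : β ∉ supportedPolytope p) :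
    betheFreeEnergy p T β = ⊤ := by
  rw [betheFreeEnergy, if_pos]
  by_contra! h
  exact hnot ⟨hβ, h⟩

theorem thermalMatrix_eq_exp {i j : Fin N} (hij : 0 < p i j) (T : ℝ) :
    thermalMatrix p T i j = Real.exp (Real.log (p i j) / T) := by
  simp [thermalMatrix, Real.rpow_def_of_pos hij, div_eq_mul_inv]

theorem thermalMatrix_eq_zero {i j : Fin N} (hij : p i j = 0) {T : ℝ} (hT : 0 < T) :
    thermalMatrix p T i j = 0 := by
  simp [thermalMatrix, hij, Real.zero_rpow, hT.ne']

theorem isBPSolution_of_isMinOn (hp : ∀ i j, 0 ≤ p i j) {T : ℝ} (hT : 0 < T)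
    {β : Matrix (Fin N) (Fin N) ℝ} (hβ : β ∈ supportedPolytope p) (hint : IsInteriorOn p β)
    (hmin : IsMinOn (betheObjective (logCost p) T) (supportedPolytope p) β) :
    IsBPSolution p T β := by
  obtain ⟨μ, ν, h⟩ := exists_multipliers (p := p)
    (g := Matrix.of fun i j => T * (Real.log (β i j) + Real.log (1 - β i j) + 2) + logCost p i j)
    fun v hrow hcol hoff => betheSlope_eq_zero_of_isMinOn hp hβ hint hmin hrow hcol hoff
  -- The `-2` removes the constant in the derivative of `betheTerm`.
  refine ⟨hβ.1, fun i => μ i / T - 2, fun j => ν j / T, fun i j => ?_⟩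
  rcases (hp i j).eq_or_lt with hij | hij
  · simp [hβ.2 i j hij.symm, thermalMatrix_eq_zero hij.symm hT]
  · have hb := hint i j hij
    have hg := h i j hij
    simp only [Matrix.of_apply, logCost] at hg
    rw [thermalMatrix_eq_exp hij, ← Real.exp_add, ← Real.exp_log (mul_pos hb.1 (sub_pos.2 hb.2)),
      Real.log_mul hb.1.ne' (sub_pos.2 hb.2).ne']
    congr 1
    field_simp
    linarith

/-- The BP equation makes `β (1 - β)` positive on the support, so no permutation matrix is a BP
solution. Off the support entries are `0` or `1`, and a `1` would annihilate the rest of its row. -/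
theorem IsBPSolution.isInteriorOn (hind : FullyIndecomposable p)
    (hN : 2 ≤ N) {T : ℝ} (hT : 0 < T) {β : Matrix (Fin N) (Fin N) ℝ} (h : IsBPSolution p T β) :
    β ∈ supportedPolytope p ∧ IsInteriorOn p β := by
  obtain ⟨hβ, μ, ν, hbp⟩ := h
  have hpos : ∀ i j, 0 < p i j → 0 < β i j := by
    intro i j hij
    refine lt_of_le_of_ne (nonneg_of_mem_doublyStochastic hβ) fun h0 => ?_
    have h1 := hbp i j
    rw [← h0, zero_mul, thermalMatrix_eq_exp hij] at h1
    exact (mul_pos (Real.exp_pos _) (Real.exp_pos _)).ne h1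
  refine ⟨⟨hβ, fun i j hij => ?_⟩, hind.isInteriorOn_of_pos hN hβ hpos⟩
  have h1 := hbp i j
  rw [thermalMatrix_eq_zero hij hT, zero_mul] at h1
  refine (mul_eq_zero.1 h1).resolve_right fun h2 => ?_
  obtain ⟨j', hj', hp'⟩ := hind.exists_ne hN i j
  exact (hpos i j' hp').ne' (eq_zero_of_eq_one hβ (k := j) (by linarith) hj')

theorem IsBPSolution.betheSlope_eq_zero (hp : ∀ i j, 0 ≤ p i j) {T : ℝ} (hT : 0 < T)
    {β v : Matrix (Fin N) (Fin N) ℝ} (h : IsBPSolution p T β) (hint : IsInteriorOn p β)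
    (hrow : ∀ i, ∑ j, v i j = 0) (hcol : ∀ j, ∑ i, v i j = 0)
    (hoff : ∀ i j, p i j = 0 → v i j = 0) : betheSlope (logCost p) T β v = 0 := by
  obtain ⟨-, μ, ν, hbp⟩ := h
  have hterm : ∀ i j, v i j * (T * (Real.log (β i j) + Real.log (1 - β i j) + 2) + logCost p i j) =
      v i j * (T * (μ i + 2)) + v i j * (T * ν j) := by
    intro i j
    rcases (hp i j).eq_or_lt with hij | hij
    · simp [hoff i j hij.symm]
    · have hb := hint i j hij
      have h1 := congrArg Real.log (hbp i j)
      rw [thermalMatrix_eq_exp hij, ← Real.exp_add, Real.log_exp,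
        Real.log_mul hb.1.ne' (sub_pos.2 hb.2).ne'] at h1
      rw [h1]
      simp only [logCost, Matrix.of_apply]
      field_simp
      ring
  simp only [betheSlope, hterm, Finset.sum_add_distrib, ← Finset.sum_mul, hrow, zero_mul,
    zero_add]
  rw [Finset.sum_comm]
  simp only [← Finset.sum_mul, hcol, zero_mul, Finset.sum_const_zero]

theorem permMatrix_not_isInteriorOn (hN : 0 < N) {σ : Equiv.Perm (Fin N)}
    (hσ : ∀ i, 0 < p i (σ i)) : ¬ IsInteriorOn p (σ.permMatrix ℝ) := by
  intro h
  have := (h ⟨0, hN⟩ _ (hσ _)).2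
  rw [permMatrix_apply_eq, if_pos rfl] at this
  exact lt_irrefl _ this

theorem IsBPSolution.betheObjective_lt (hp : ∀ i j, 0 ≤ p i j) (hind : FullyIndecomposable p)
    (hN : 2 ≤ N) (hcard : 2 * N < {e : Fin N × Fin N | 0 < p e.1 e.2}.ncard) {T : ℝ} (hT : 0 < T)
    {β : Matrix (Fin N) (Fin N) ℝ} (h : IsBPSolution p T β) {σ : Equiv.Perm (Fin N)}
    (hσ : ∀ i, 0 < p i (σ i)) :
    betheObjective (logCost p) T β < betheObjective (logCost p) T (σ.permMatrix ℝ) := by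
  obtain ⟨hβ, hint⟩ := h.isInteriorOn hind hN hT
  have hσΩ := permMatrix_mem_supportedPolytope hσ
  refine betheObjective_lt_of_betheSlope_eq_zero hp hind hcard hT hβ hint hσΩ
    (fun h => permMatrix_not_isInteriorOn (by omega) hσ (h ▸ hint)) ?_
  refine h.betheSlope_eq_zero hp hT hint (fun i => ?_) (fun j => ?_) fun i j hij => ?_
  · simp only [Matrix.sub_apply, Finset.sum_sub_distrib, sum_row_of_mem_doublyStochastic hβ.1,
      sum_row_of_mem_doublyStochastic hσΩ.1, sub_self]
  · simp only [Matrix.sub_apply, Finset.sum_sub_distrib, sum_col_of_mem_doublyStochastic hβ.1,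
      sum_col_of_mem_doublyStochastic hσΩ.1, sub_self]
  · rw [Matrix.sub_apply, hβ.2 i j hij, hσΩ.2 i j hij, sub_zero]

/-! ### Uniqueness and continuity of the minimizer -/

theorem sum_one_sub_nonneg {β : Matrix (Fin N) (Fin N) ℝ} (hβ : β ∈ supportedPolytope p)
    (σ : Equiv.Perm (Fin N)) : 0 ≤ ∑ i, (1 - β i (σ i)) :=
  Finset.sum_nonneg fun _ _ => sub_nonneg.2 (le_one_of_mem_doublyStochastic hβ.1)

theorem isInteriorOn_or_eq_of_isMinOn (hp : ∀ i j, 0 ≤ p i j) (hind : FullyIndecomposable p)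
    (hN : 2 ≤ N) {σ : Equiv.Perm (Fin N)} (hσ : IsMLMatching p σ) {T : ℝ} (hT : 0 < T)
    {β : Matrix (Fin N) (Fin N) ℝ} (hβ : β ∈ supportedPolytope p)
    (hmin : IsMinOn (betheObjective (logCost p) T) (supportedPolytope p) β) :
    IsInteriorOn p β ∨ β = σ.permMatrix ℝ := by
  have hσp := hσ.pos hp hN
  refine (isInteriorOn_or_eq_permMatrix hp hind hN hT hβ hmin).imp_right ?_
  rintro ⟨τ, hτ, rfl⟩
  by_contra hne
  have hτσ : τ ≠ σ := fun h => hne (h ▸ rfl)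
  have h1 := isMinOn_iff.1 hmin _ (permMatrix_mem_supportedPolytope hσp)
  rw [betheObjective_permMatrix, betheObjective_permMatrix] at h1
  have h2 := hσ.sum_log_lt hτ hτσ
  simp only [logCost, Matrix.of_apply, Finset.sum_neg_distrib] at h1
  linarith

/-- An interior minimizer excludes any other by strict convexity, and `σ` is the only non-interior
candidate. -/
theorem eq_of_isMinOn_of_isMinOn (hp : ∀ i j, 0 ≤ p i j) (hind : FullyIndecomposable p)
    (hN : 2 ≤ N) (hcard : 2 * N < {e : Fin N × Fin N | 0 < p e.1 e.2}.ncard)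
    {σ : Equiv.Perm (Fin N)} (hσ : IsMLMatching p σ) {T : ℝ} (hT : 0 < T)
    {β γ : Matrix (Fin N) (Fin N) ℝ} (hβ : β ∈ supportedPolytope p)
    (hβmin : IsMinOn (betheObjective (logCost p) T) (supportedPolytope p) β)
    (hγ : γ ∈ supportedPolytope p)
    (hγmin : IsMinOn (betheObjective (logCost p) T) (supportedPolytope p) γ) : β = γ := by
  rcases isInteriorOn_or_eq_of_isMinOn hp hind hN hσ hT hβ hβmin with hi | hβσ
  · exact (eq_of_isMinOn_of_isInteriorOn hp hind hcard hT hβ hi hβmin hγ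
      (isMinOn_iff.1 hγmin _ hβ)).symm
  rcases isInteriorOn_or_eq_of_isMinOn hp hind hN hσ hT hγ hγmin with hi | hγσ
  · exact eq_of_isMinOn_of_isInteriorOn hp hind hcard hT hγ hi hγmin hβ
      (isMinOn_iff.1 hβmin _ hγ)
  · rw [hβσ, hγσ]

/-- A selection of minimizers is continuous wherever the minimizer is unique. -/
theorem continuousAt_of_unique_minimizer {c : Matrix (Fin N) (Fin N) ℝ}
    {m : ℝ → Matrix (Fin N) (Fin N) ℝ} (hm : ∀ T, m T ∈ supportedPolytope p)
    (hmin : ∀ T, IsMinOn (betheObjective c T) (supportedPolytope p) (m T)) {T₀ : ℝ}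
    (huniq : ∀ β ∈ supportedPolytope p,
      IsMinOn (betheObjective c T₀) (supportedPolytope p) β → β = m T₀) :
    ContinuousAt m T₀ := by
  refine isCompact_supportedPolytope.tendsto_nhds_of_unique_mapClusterPt
    (Filter.Eventually.of_forall hm) fun y hy hcl => huniq y hy (isMinOn_iff.2 fun γ hγ => ?_)
  by_contra! hlt
  have hcont : Continuous fun x : ℝ × Matrix (Fin N) (Fin N) ℝ =>
      betheObjective c x.1 x.2 - betheObjective c x.1 γ :=
    (continuous_betheObjective c).sub
      ((continuous_betheObjective c).comp (continuous_fst.prodMk continuous_const))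
  have hev := hcont.continuousAt.eventually (lt_mem_nhds (a := 0) (b := _)
    (show 0 < betheObjective c (T₀, y).1 (T₀, y).2 - betheObjective c (T₀, y).1 γ from
      sub_pos.2 hlt))
  rw [nhds_prod_eq, Filter.eventually_prod_iff] at hev
  obtain ⟨P, hP, Q, hQ, hPQ⟩ := hev
  obtain ⟨T, hQT, hPT⟩ := ((hcl.frequently hQ).and_eventually hP).exists
  have h1 := hPQ hPT hQT
  have h2 := isMinOn_iff.1 (hmin T) γ hγ
  simp only [sub_pos] at h1
  exact absurd h2 h1.not_ge

/-! ### The critical temperature -/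

theorem exists_isMinOn_permMatrix (hp : ∀ i j, 0 ≤ p i j) (hN : 2 ≤ N)
    {σ : Equiv.Perm (Fin N)} (hσ : IsMLMatching p σ) :
    ∃ T > 0, IsMinOn (betheObjective (logCost p) T) (supportedPolytope p) (σ.permMatrix ℝ) := by
  obtain ⟨k, hk, hgrow⟩ := hσ.exists_linear_growth hp hN
  have hN0 : (0 : ℝ) < N := by exact_mod_cast (by omega : 0 < N)
  -- At `T = k / N` the entropy gain, at most `T * N` times the distance to `σ`, is matched by the
  -- cost growth `k`.
  refine ⟨k / N, div_pos hk hN0, isMinOn_iff.2 fun β hβ => ?_⟩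
  rw [betheObjective_permMatrix, betheObjective_eq_add]
  have h1 := hgrow β hβ
  have h2 : -(N * ∑ i, (1 - β i (σ i))) ≤ ∑ i, ∑ j, betheTerm (β i j) := by
    rw [Finset.mul_sum, ← Finset.sum_neg_distrib]
    refine Finset.sum_le_sum fun i _ => ?_
    simpa using neg_mul_le_sum_betheTerm (fun j => nonneg_of_mem_doublyStochastic hβ.1)
      (sum_row_of_mem_doublyStochastic hβ.1 i) (σ i)
  have h3 := mul_le_mul_of_nonneg_left h2 (div_pos hk hN0).le
  have h4 : k / N * -(N * ∑ i, (1 - β i (σ i))) = -(k * ∑ i, (1 - β i (σ i))) := by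
    field_simp
  rw [h4] at h3
  simp only [logCost, Matrix.of_apply]
  linarith

/-! ### Singularity of the critical matrix -/

theorem one_le_sum_erase_div {ι : Type*} [Fintype ι] [DecidableEq ι] {b : ι → ℝ}
    (hb : ∀ j, 0 ≤ b j) (hsum : ∑ j, b j = 1) {k : ι} (h0 : 0 < b k) (h1 : b k < 1) :
    1 ≤ (∑ j ∈ Finset.univ.erase k, b j * (1 - b j)) / (b k * (1 - b k)) := by
  have herase : ∑ j ∈ Finset.univ.erase k, b j = 1 - b k := by
    rw [← hsum, ← Finset.add_sum_erase _ _ (Finset.mem_univ k)]; ring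
  rw [one_le_div (mul_pos h0 (sub_pos.2 h1)), ← herase, Finset.mul_sum]
  refine Finset.sum_le_sum fun j hj => ?_
  have : b j ≤ 1 - b k := herase ▸ Finset.single_le_sum (fun i _ => hb i) hj
  nlinarith [hb j]

theorem sum_erase_div_le {ι : Type*} [Fintype ι] [DecidableEq ι] {b : ι → ℝ}
    (hsum : ∑ j, b j = 1) {k : ι} (h0 : 0 < b k) (h1 : b k < 1) :
    (∑ j ∈ Finset.univ.erase k, b j * (1 - b j)) / (b k * (1 - b k)) ≤ 1 / b k := by
  have herase : ∑ j ∈ Finset.univ.erase k, b j = 1 - b k := by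
    rw [← hsum, ← Finset.add_sum_erase _ _ (Finset.mem_univ k)]; ring
  have h1' := sub_pos.2 h1
  rw [div_le_div_iff₀ (mul_pos h0 h1') h0, one_mul, mul_comm]
  refine mul_le_mul_of_nonneg_left ?_ h0.le
  rw [← herase]
  exact Finset.sum_le_sum fun j _ => by nlinarith [sq_nonneg (b j)]

theorem continuousAt_thermalMatrix {T : ℝ} (hT : 0 < T) (i j : Fin N) :
    ContinuousAt (fun T => thermalMatrix p T i j) T := by
  simp only [thermalMatrix, Matrix.of_apply]
  exact continuousAt_const.rpow (continuousAt_const.div continuousAt_id hT.ne')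
    (Or.inr (one_div_pos.2 hT))

/-- The ratio of the off-matching to the on-matching part of row `i` of `β (1 - β)`. -/
noncomputable def rowRatio {N : ℕ} (σ : Equiv.Perm (Fin N)) (β : Matrix (Fin N) (Fin N) ℝ)
    (i : Fin N) : ℝ :=
  (∑ j ∈ Finset.univ.erase (σ i), β i j * (1 - β i j)) / (β i (σ i) * (1 - β i (σ i)))

theorem IsBPSolution.det_eq_zero {T : ℝ} {β : Matrix (Fin N) (Fin N) ℝ} (h : IsBPSolution p T β)
    {σ : Equiv.Perm (Fin N)} (hN : 0 < N) (hσ : ∀ i, 0 < β i (σ i) ∧ β i (σ i) < 1) :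
    (Matrix.of fun i j => thermalMatrix p T i j -
      (1 + rowRatio σ β i) * σ.permMatrix ℝ i j * thermalMatrix p T i j).det = 0 := by
  obtain ⟨-, μ, ν, hbp⟩ := h
  rw [← Matrix.exists_mulVec_eq_zero_iff]
  refine ⟨fun j => Real.exp (ν j), fun h0 => (Real.exp_pos (ν ⟨0, hN⟩)).ne' (congrFun h0 ⟨0, hN⟩),
    funext fun i => ?_⟩
  have hb := mul_pos (hσ i).1 (sub_pos.2 (hσ i).2)
  have hr : rowRatio σ β i * (β i (σ i) * (1 - β i (σ i))) =
      ∑ j ∈ Finset.univ.erase (σ i), β i j * (1 - β i j) := div_mul_cancel₀ _ hb.ne'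
  have hentry : ∀ j, thermalMatrix p T i j * Real.exp (ν j) =
      Real.exp (-μ i) * (β i j * (1 - β i j)) := fun j => by
    rw [hbp i j, Real.exp_add, Real.exp_neg]
    field_simp
  have hsum : ∀ j, (thermalMatrix p T i j -
      (1 + rowRatio σ β i) * σ.permMatrix ℝ i j * thermalMatrix p T i j) * Real.exp (ν j) =
      Real.exp (-μ i) * (β i j * (1 - β i j) -
        (1 + rowRatio σ β i) * σ.permMatrix ℝ i j * (β i j * (1 - β i j))) := fun j => by
    rw [sub_mul, mul_assoc _ (thermalMatrix p T i j), hentry]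
    ring
  simp only [Matrix.mulVec, dotProduct, Matrix.of_apply, Pi.zero_apply, hsum]
  rw [← Finset.mul_sum, ← Finset.add_sum_erase _ _ (Finset.mem_univ (σ i)),
    Finset.sum_congr rfl fun j hj => show _ = β i j * (1 - β i j) by
      rw [permMatrix_apply_eq, if_neg (Finset.ne_of_mem_erase hj)]; ring,
    permMatrix_apply_eq, if_pos rfl, ← hr]
  ring

/-- If interior belief-propagation solutions converge to `σ` as the temperature decreases to
`Tc`, the critical matrix is singular at `Tc`. -/
theorem det_criticalMatrix_eq_zero {σ : Equiv.Perm (Fin N)} (hσ : ∀ i, 0 < p i (σ i)) (hN : 0 < N)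
    {Tc : ℝ} (hTc : 0 < Tc) {m : ℝ → Matrix (Fin N) (Fin N) ℝ} (hm : ContinuousAt m Tc)
    (hmσ : m Tc = σ.permMatrix ℝ)
    (hbp : ∀ T > Tc, IsBPSolution p T (m T) ∧ IsInteriorOn p (m T)) :
    (criticalMatrix p σ Tc).det = 0 := by
  have hmT : Filter.Tendsto m (nhdsWithin Tc (Set.Ioi Tc)) (nhds (σ.permMatrix ℝ)) :=
    hmσ ▸ hm.mono_left nhdsWithin_le_nhds
  have hself : ∀ᶠ T in nhdsWithin Tc (Set.Ioi Tc), T > Tc := self_mem_nhdsWithin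
  have hr : ∀ i, Filter.Tendsto (fun T => rowRatio σ (m T) i) (nhdsWithin Tc (Set.Ioi Tc))
      (nhds 1) := by
    intro i
    have hb : Filter.Tendsto (fun T => 1 / m T i (σ i)) (nhdsWithin Tc (Set.Ioi Tc)) (nhds 1) := by
      have h1 : Filter.Tendsto (fun T => m T i (σ i)) (nhdsWithin Tc (Set.Ioi Tc)) (nhds 1) := by
        have := ((continuous_id.matrix_elem i (σ i)).tendsto (σ.permMatrix ℝ)).comp hmT
        rwa [id, permMatrix_apply_eq, if_pos rfl] at this
      simpa only [one_div, inv_one] using h1.inv₀ one_ne_zero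
    -- The row ratio lies between `1` and `1 / m T i (σ i)`, and the matching entry tends to `1`.
    refine tendsto_of_tendsto_of_tendsto_of_le_of_le' tendsto_const_nhds hb ?_ ?_
    · filter_upwards [hself] with T hT
      have hT' := hbp T hT
      have hi := hT'.2 i _ (hσ i)
      exact one_le_sum_erase_div (fun j => nonneg_of_mem_doublyStochastic hT'.1.1)
        (sum_row_of_mem_doublyStochastic hT'.1.1 i) hi.1 hi.2
    · filter_upwards [hself] with T hT
      have hT' := hbp T hT
      have hi := hT'.2 i _ (hσ i)
      exact sum_erase_div_le (sum_row_of_mem_doublyStochastic hT'.1.1 i) hi.1 hi.2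
  have hmat : Filter.Tendsto (fun T => (Matrix.of fun i j => thermalMatrix p T i j -
      (1 + rowRatio σ (m T) i) * σ.permMatrix ℝ i j * thermalMatrix p T i j :
        Matrix (Fin N) (Fin N) ℝ)) (nhdsWithin Tc (Set.Ioi Tc)) (nhds (criticalMatrix p σ Tc)) := by
    refine tendsto_pi_nhds.2 fun i => tendsto_pi_nhds.2 fun j => ?_
    have hP : Filter.Tendsto (fun T => thermalMatrix p T i j) (nhdsWithin Tc (Set.Ioi Tc))
        (nhds (thermalMatrix p Tc i j)) :=
      (continuousAt_thermalMatrix hTc i j).mono_left nhdsWithin_le_nhds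
    have := hP.sub ((((hr i).const_add 1).mul_const (σ.permMatrix ℝ i j)).mul hP)
    rw [one_add_one_eq_two] at this
    exact this
  have hdet := ((continuous_id.matrix_det).tendsto (criticalMatrix p σ Tc)).comp hmat
  refine tendsto_nhds_unique hdet (tendsto_const_nhds.congr' ?_)
  filter_upwards [hself] with T hT
  have hT' := hbp T hT
  exact (hT'.1.det_eq_zero hN fun i => hT'.2 i _ (hσ i)).symm

theorem exists_critical_temperature (hp : ∀ i j, 0 ≤ p i j) (hind : FullyIndecomposable p)
    (hN : 2 ≤ N) (hcard : 2 * N < {e : Fin N × Fin N | 0 < p e.1 e.2}.ncard)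
    {σ : Equiv.Perm (Fin N)} (hσ : IsMLMatching p σ) :
    ∃ Tc > 0,
      IsMinOn (betheObjective (logCost p) Tc) (supportedPolytope p) (σ.permMatrix ℝ) ∧
      (∀ T > Tc,
        ¬ IsMinOn (betheObjective (logCost p) T) (supportedPolytope p) (σ.permMatrix ℝ)) ∧
      ∀ T, 0 < T → T < Tc → ¬ ∃ β, IsBPSolution p T β := by
  let A : Set ℝ := {T | 0 < T ∧
    IsMinOn (betheObjective (logCost p) T) (supportedPolytope p) (σ.permMatrix ℝ)}
  obtain ⟨T₁, hT₁, hmin₁⟩ := exists_isMinOn_permMatrix hp hN hσ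
  have hne : A.Nonempty := ⟨T₁, hT₁, hmin₁⟩
  have hbdd : BddAbove A := by
    obtain ⟨β, hβ, hneg⟩ := exists_sum_betheTerm_neg hp hind hN hcard
    refine ⟨(∑ i, ∑ j, logCost p i j * β i j - ∑ i, logCost p i (σ i)) /
      (-∑ i, ∑ j, betheTerm (β i j)), fun T hT => ?_⟩
    have h := isMinOn_iff.1 hT.2 β hβ
    rw [betheObjective_permMatrix, betheObjective_eq_add] at h
    rw [le_div_iff₀ (neg_pos.2 hneg)]
    linarith
  have hTc : 0 < sSup A := hT₁.trans_le (le_csSup hbdd ⟨hT₁, hmin₁⟩)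
  refine ⟨sSup A, hTc, isMinOn_iff.2 fun β hβ => ?_, fun T hT hmin => ?_, ?_⟩
  · have hcont : ∀ γ, Continuous fun T => betheObjective (logCost p) T γ := fun γ =>
      (continuous_betheObjective (logCost p)).comp (continuous_id.prodMk continuous_const)
    have hsub : A ⊆ {T | betheObjective (logCost p) T (σ.permMatrix ℝ) ≤
        betheObjective (logCost p) T β} := fun T hT => isMinOn_iff.1 hT.2 β hβ
    exact closure_minimal hsub (isClosed_le (hcont _) (hcont _)) (csSup_mem_closure hne hbdd)
  · exact (le_csSup hbdd ⟨hTc.trans hT, hmin⟩).not_gt hT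
  · rintro T hT0 hT ⟨β, hbp⟩
    obtain ⟨T', ⟨-, hmin⟩, hTT'⟩ := exists_lt_of_lt_csSup hne hT
    obtain ⟨hβ, -⟩ := hbp.isInteriorOn hind hN hT0
    have h1 := hbp.betheObjective_lt hp hind hN hcard hT0 (hσ.pos hp hN)
    have h2 := isMinOn_iff.1 hmin β hβ
    obtain ⟨k, hk, hgrow⟩ := hσ.exists_linear_growth hp hN
    have h3 := (mul_nonneg hk.le (sum_one_sub_nonneg hβ σ)).trans (hgrow β hβ)
    rw [betheObjective_permMatrix, betheObjective_eq_add] at h1 h2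
    simp only [logCost, Matrix.of_apply] at h1 h2
    -- `β` beats `σ` at `T` although its cost is no smaller, so its entropy sum is negative; raising
    -- the temperature to `T'` widens the advantage and contradicts minimality of `σ` there.
    have h4 : ∑ i, ∑ j, betheTerm (β i j) < 0 := by
      by_contra! h
      have := mul_nonneg hT0.le h
      linarith
    have h5 := mul_lt_mul_of_neg_right hTT' h4
    linarith

end BeliefPropagation

/-! ### The branch of minimizers above the critical temperature -/

theorem proposition1 (N : ℕ) (p : Matrix (Fin N) (Fin N) ℝ) (hp : ∀ i j, 0 ≤ p i j)
    (hind : FullyIndecomposable p)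
    (hcard : 2 * N < {e : Fin N × Fin N | 0 < p e.1 e.2}.ncard)
    (σ : Equiv.Perm (Fin N)) (hσ : IsMLMatching p σ) :
    ∃ Tc : ℝ, 0 < Tc ∧ (criticalMatrix p σ Tc).det = 0 ∧
      (∃ ε : ℝ, 0 < ε ∧ ∃ β : ℝ → Matrix (Fin N) (Fin N) ℝ,
        ContinuousOn β (Set.Ico Tc (Tc + ε)) ∧ β Tc = σ.permMatrix ℝ ∧
        ∀ T ∈ Set.Ioo Tc (Tc + ε),
          IsBPSolution p T (β T) ∧
          (∀ i j, 0 < p i j → 0 < β T i j ∧ β T i j < 1) ∧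
          IsLocalMinOn (betheFreeEnergy p T)
            (doublyStochastic ℝ (Fin N) : Set (Matrix (Fin N) (Fin N) ℝ)) (β T) ∧
          betheFreeEnergy p T (β T) < betheFreeEnergy p T (σ.permMatrix ℝ)) ∧
      ∀ T : ℝ, 0 < T → T < Tc →
        ¬ ∃ β : Matrix (Fin N) (Fin N) ℝ, IsBPSolution p T β ∧ ∃ i j, 0 < β i j ∧ β i j < 1 := by
  have hN : 2 ≤ N := by
    by_contra! hlt
    have h1 := Set.ncard_le_card {e : Fin N × Fin N | 0 < p e.1 e.2}
    simp only [Nat.card_eq_fintype_card, Fintype.card_prod, Fintype.card_fin] at h1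
    interval_cases N <;> omega
  have hσp := hσ.pos hp hN
  have hσΩ := permMatrix_mem_supportedPolytope hσp
  obtain ⟨Tc, hTc, hminc, habove, hbelow⟩ := exists_critical_temperature hp hind hN hcard hσ
  choose m hm hmin using exists_isMinOn_betheObjective ⟨_, hσΩ⟩ (logCost p)
  have hmσ : m Tc = σ.permMatrix ℝ :=
    eq_of_isMinOn_of_isMinOn hp hind hN hcard hσ hTc (hm Tc) (hmin Tc) hσΩ hminc
  have hcont : ∀ T, 0 < T → ContinuousAt m T := fun T hT =>
    continuousAt_of_unique_minimizer hm hmin fun β hβ hβmin =>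
      eq_of_isMinOn_of_isMinOn hp hind hN hcard hσ hT hβ hβmin (hm T) (hmin T)
  have hint : ∀ T > Tc, IsInteriorOn p (m T) := fun T hT =>
    (isInteriorOn_or_eq_of_isMinOn hp hind hN hσ (hTc.trans hT) (hm T) (hmin T)).resolve_right
      fun h => habove T hT (h ▸ hmin T)
  have hbp : ∀ T > Tc, IsBPSolution p T (m T) := fun T hT =>
    isBPSolution_of_isMinOn hp (hTc.trans hT) (hm T) (hint T hT) (hmin T)
  -- The value `ε = 1` is arbitrary: the branch exists for all `T ≥ Tc` and consists of global
  -- minimizers.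
  refine ⟨Tc, hTc, ?_, ⟨1, one_pos, m, ?_, hmσ, ?_⟩, ?_⟩
  · exact det_criticalMatrix_eq_zero hσp (by omega) hTc (hcont Tc hTc) hmσ fun T hT =>
      ⟨hbp T hT, hint T hT⟩
  · exact fun T hT => (hcont T (hTc.trans_le hT.1)).continuousWithinAt
  · intro T hT
    have hT0 := hTc.trans hT.1
    refine ⟨hbp T hT.1, hint T hT.1, Filter.eventually_of_mem self_mem_nhdsWithin fun β hβ => ?_, ?_⟩
    · rw [betheFreeEnergy_eq_betheObjective hp hT0 (hm T)]
      by_cases hβΩ : β ∈ supportedPolytope p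
      · rw [betheFreeEnergy_eq_betheObjective hp hT0 hβΩ]
        exact EReal.coe_le_coe_iff.2 (isMinOn_iff.1 (hmin T) β hβΩ)
      · rw [betheFreeEnergy_eq_top hβ hβΩ]
        exact le_top
    · rw [betheFreeEnergy_eq_betheObjective hp hT0 (hm T),
        betheFreeEnergy_eq_betheObjective hp hT0 hσΩ]
      exact EReal.coe_lt_coe_iff.2 ((hbp T hT.1).betheObjective_lt hp hind hN hcard hT0 hσp)
  · rintro T hT0 hT ⟨β, hβ, -⟩
    exact hbelow T hT0 hT ⟨β, hβ⟩
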